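/- Let $\mathcal M$ be a von Neumann algebra acting on a complex Hilbert space $H$, with self-adjoint part $\mathcal M^{sa}$, and let $a$ be an injective positive self-adjoint (possibly unbounded) operator affiliated with $\mathcal M$. For $t>0$ let $a_t\in\mathcal M^+$ be the closure of $t\,a(t+a)^{-1}$. For a positive ultraweakly continuous functional $\varphi\in\mathcal M_*^+$ put $\varphi(a)=\lim_{t\to+\infty}\varphi(a_t)\in[0,+\infty]$. Let $\mathfrak D_a^+=\{\varphi\in\mathcal M_*^+:\varphi(a)<+\infty\}$, let $\mathfrak D_a^h=\mathfrak D_a^+-\mathfrak D_a^+$ (a real vector space), and for $\varphi\in\mathfrak D_a^h$ let $$\|\varphi\|_a=\inf\{\varphi_1(a)+\varphi_2(a):\varphi=\varphi_1-\varphi_2,\ \varphi_1,\varphi_2\in\mathfrak D_a^+\}.$$ Let $L_\infty^{sa}(a)$ be the real vector space of all linear functionals $\ell:\mathfrak D_a^h\to\mathbb R$ for which there is $\lambda\in\mathbb R$ with $-\lambda a\le\ell\le\lambda a$, that is, $-\lambda\varphi(a)\le\ell(\varphi)\le\lambda\varphi(a)$ for all $\varphi\in\mathfrak D_a^+$; put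 $\|\ell\|^a=\inf\{\lambda\ge0:-\lambda a\le\ell\le\lambda a\}$. For $x\in\mathcal M$ let $\widehat{a^{1/2}xa^{1/2}}$ be the sesquilinear form $(f,g)\mapsto\langle x a^{1/2}f,a^{1/2}g\rangle$ on $D(a^{1/2})\times D(a^{1/2})$. Let $\mathcal S_a(\mathcal M^{sa})=\{\widehat{a^{1/2}xa^{1/2}}:x\in\mathcal M^{sa}\}$, a real vector space of forms, with the seminorm $$p_a(B)=\inf\{\lambda\ge0:\ -\lambda\|a^{1/2}f\|^2\le B(f,f)\le\lambda\|a^{1/2}f\|^2\ \text{ for all } f\in D(a^{1/2})\}.$$ Then: (1) $L_\infty^{sa}(a)$ is the dual of $(\mathfrak D_a^h,\|\cdot\|_a)$: a linear functional $\ell:\mathfrak D_a^h\to\mathbb R$ belongs to $L_\infty^{sa}(a)$ if and only if it is bounded with respect to $\|\cdot\|_a$, and then $\|\ell\|^a$ is its dual norm $\inf\{C\ge0:|\ell(\varphi)|\le C\|\varphi\|_a\ \text{ for all }\varphi\in\mathfrak D_a^h\}$. (2) There is a real-linear bijection $\Phi:\mathcal S_a(\mathcal M^{sa})\to L_\infty^{sa}(a)$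 such that for all $x\in\mathcal M^{sa}$ and $\varphi\in\mathfrak D_a^h$ the limit $\lim_{t\to+\infty}\varphi(a_t^{1/2}x\,a_t^{1/2})$ exists and $$\Phi\big(\widehat{a^{1/2}xa^{1/2}}\big)(\varphi)=\lim_{t\to+\infty}\varphi\big(a_t^{1/2}x\,a_t^{1/2}\big),$$ and $\|\Phi(B)\|^a=p_a(B)$ for all $B\in\mathcal S_a(\mathcal M^{sa})$. In particular, every bounded functional on $(\mathfrak D_a^h,\|\cdot\|_a)$ comes from exactly one form in $\mathcal S_a(\mathcal M^{sa})$. -/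

import Mathlib

open Filter Topology
open scoped ENNReal ComplexOrder InnerProductSpace

/-- A positive self-adjoint (possibly unbounded) operator affiliated with a von Neumann algebra:
affiliation means that it commutes with every unitary `u` of the commutant. (Density of the domain
is part of `IsSelfAdjoint` for partially defined operators.) -/
structure PosAffiliated {H : Type*} [NormedAddCommGroup H] [InnerProductSpace ℂ H]
    [CompleteSpace H] (M : VonNeumannAlgebra H) where
  op : H →ₗ.[ℂ] H
  isSelfAdjoint : IsSelfAdjoint op
  nonneg : ∀ x : op.domain, 0 ≤ ⟪op x, (x : H)⟫_ℂ
  affiliated : ∀ u : H →L[ℂ] H, u ∈ unitary (H →L[ℂ] H) → u ∈ M.commutant →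
    ∀ x : op.domain, ∃ h : u x ∈ op.domain, op ⟨u x, h⟩ = u (op x)

namespace PosAffiliated

variable {H : Type*} [NormedAddCommGroup H] [InnerProductSpace ℂ H] [CompleteSpace H]
  {M : VonNeumannAlgebra H} (a : PosAffiliated M)

/-! ### The bounded operators `a_t = closure of t a (t + a)⁻¹` -/

theorem symm_op (x y : a.op.domain) : ⟪a.op x, (y : H)⟫_ℂ = ⟪(x : H), a.op y⟫_ℂ := by
  have h1 : a.op.adjoint = a.op := a.isSelfAdjoint
  have h2 := LinearPMap.adjoint_isFormalAdjoint a.isSelfAdjoint.dense_domain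
  rw [h1] at h2
  exact h2 x y

theorem re_nonneg (x : a.op.domain) : 0 ≤ (⟪a.op x, (x : H)⟫_ℂ).re :=
  (Complex.le_def.1 (a.nonneg x)).1

theorem norm_le (t : ℝ) (x : a.op.domain) :
    t * ‖(x : H)‖ ≤ ‖(t : ℂ) • (x : H) + a.op x‖ := by
  by_cases hx : (x : H) = 0
  · simp [hx]
  have hpos : 0 < ‖(x : H)‖ := norm_pos_iff.2 hx
  have h1 : t * ‖(x : H)‖ ^ 2 ≤ (⟪(t : ℂ) • (x : H) + a.op x, (x : H)⟫_ℂ).re := by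
    rw [inner_add_left, inner_smul_left, inner_self_eq_norm_sq_to_K, Complex.add_re]
    have := a.re_nonneg x
    have h2 : ((starRingEnd ℂ) (t : ℂ) * ((‖(x : H)‖ : ℝ) : ℂ) ^ 2).re = t * ‖(x : H)‖ ^ 2 := by
      rw [Complex.conj_ofReal]; norm_cast
    erw [h2]; linarith
  have h3 : (⟪(t : ℂ) • (x : H) + a.op x, (x : H)⟫_ℂ).re
      ≤ ‖(t : ℂ) • (x : H) + a.op x‖ * ‖(x : H)‖ :=
    (Complex.re_le_norm _).trans (norm_inner_le_norm _ _)
  nlinarith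

theorem norm_op_le (t : ℝ) (ht : 0 < t) (x : a.op.domain) :
    ‖a.op x‖ ≤ 2 * ‖(t : ℂ) • (x : H) + a.op x‖ := by
  have h1 := a.norm_le t x
  have h2 : ‖a.op x‖ ≤ ‖(t : ℂ) • (x : H) + a.op x‖ + ‖(t : ℂ) • (x : H)‖ := by
    have := norm_sub_le ((t : ℂ) • (x : H) + a.op x) ((t : ℂ) • (x : H))
    simpa using this
  rw [norm_smul, Complex.norm_real, Real.norm_of_nonneg ht.le] at h2
  linarith

/-- The operator `t + a` on the domain of `a`. -/
def shift (t : ℝ) : a.op.domain →ₗ[ℂ] H := (t : ℂ) • a.op.domain.subtype + a.op.toFun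

theorem shift_apply (t : ℝ) (x : a.op.domain) : a.shift t x = (t : ℂ) • (x : H) + a.op x := rfl

theorem shift_injective (t : ℝ) (ht : 0 < t) : Function.Injective (a.shift t) := by
  rw [injective_iff_map_eq_zero]
  intro x hx
  have h := a.norm_le t x
  rw [← shift_apply, hx, norm_zero] at h
  have h3 : ‖(x : H)‖ = 0 := by nlinarith [norm_nonneg (x : H)]
  exact Subtype.ext (norm_eq_zero.1 h3)

theorem shift_surjective (t : ℝ) (ht : 0 < t) : Function.Surjective (a.shift t) := by
  let G : Submodule ℂ (H × H) := a.op.graph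
  have hG : IsClosed (G : Set (H × H)) := a.isSelfAdjoint.isClosed
  have : CompleteSpace G := hG.completeSpace_coe
  let L : G →L[ℂ] H :=
    ((t : ℂ) • ContinuousLinearMap.fst ℂ H H + ContinuousLinearMap.snd ℂ H H).comp G.subtypeL
  have hL : ∀ g : G, ∃ x : a.op.domain, (g : H × H) = ((x : H), a.op x) ∧ L g = a.shift t x := by
    rintro ⟨⟨p, q⟩, hg⟩
    obtain ⟨x, hx1, hx2⟩ := (LinearPMap.mem_graph_iff _).1 hg
    simp only at hx1 hx2
    subst hx1 hx2
    exact ⟨x, rfl, rfl⟩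
  have hanti : ∃ K, AntilipschitzWith K L := by
    refine ⟨⟨2 + 1 / t, by positivity⟩, ?_⟩
    refine ContinuousLinearMap.antilipschitz_of_bound _ fun g => ?_
    obtain ⟨x, hx, hLx⟩ := hL g
    have h1 := a.norm_le t x
    have h2 := a.norm_op_le t ht x
    rw [← shift_apply, ← hLx] at h1 h2
    change ‖(g : H × H)‖ ≤ (2 + 1 / t) * ‖L g‖
    rw [hx, Prod.norm_def]
    have h3 : ‖(x : H)‖ ≤ 1 / t * ‖L g‖ := by
      rw [one_div, inv_mul_eq_div, le_div_iff₀ ht]; linarith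
    have h4 : 0 ≤ 1 / t * ‖L g‖ := by positivity
    refine max_le ?_ ?_ <;> simp only <;> nlinarith [norm_nonneg (L g)]
  obtain ⟨K, hK⟩ := hanti
  have hcl : IsClosed (Set.range L) := hK.isClosed_range L.uniformContinuous
  have hrange : (LinearMap.range (a.shift t) : Set H) = Set.range L := by
    ext y
    constructor
    · rintro ⟨x, rfl⟩
      exact ⟨⟨((x : H), a.op x), a.op.mem_graph x⟩, rfl⟩
    · rintro ⟨g, rfl⟩
      obtain ⟨x, -, hx⟩ := hL g
      exact ⟨x, hx.symm⟩
  have hcl' : IsClosed (LinearMap.range (a.shift t) : Set H) := hrange ▸ hcl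
  rw [← LinearMap.range_eq_top]
  have : CompleteSpace (LinearMap.range (a.shift t)) := hcl'.completeSpace_coe
  rw [← Submodule.orthogonal_eq_bot_iff, Submodule.eq_bot_iff]
  intro y hy
  have h0 : ∀ x : a.op.domain, ⟪(-(t : ℂ)) • y, (x : H)⟫_ℂ = ⟪y, a.op x⟫_ℂ := by
    intro x
    have := (Submodule.mem_orthogonal' _ _).1 hy (a.shift t x) ⟨x, rfl⟩
    rw [shift_apply, inner_add_right, inner_smul_right] at this
    rw [inner_smul_left, map_neg, Complex.conj_ofReal]
    linear_combination -this
  have hdom : y ∈ a.op.adjoint.domain := LinearPMap.mem_adjoint_domain_of_exists _ ⟨_, h0⟩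
  have hval : a.op.adjoint ⟨y, hdom⟩ = (-(t : ℂ)) • y :=
    LinearPMap.adjoint_apply_eq a.isSelfAdjoint.dense_domain _ h0
  have hadj : a.op.adjoint = a.op := a.isSelfAdjoint
  have key : ∃ h : y ∈ a.op.domain, a.op ⟨y, h⟩ = (-(t : ℂ)) • y := by
    rw [← hadj]; exact ⟨hdom, hval⟩
  obtain ⟨h, hy2⟩ := key
  have h3 := a.norm_le t ⟨y, h⟩
  rw [hy2] at h3
  simp only [neg_smul, add_neg_cancel, norm_zero] at h3
  exact norm_eq_zero.1 (by nlinarith [norm_nonneg y])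

theorem exists_yosida (t : ℝ) (ht : 0 < t) :
    ∃ T : H →L[ℂ] H, ∀ x : a.op.domain, T ((t : ℂ) • (x : H) + a.op x) = (t : ℂ) • a.op x := by
  let e := LinearEquiv.ofBijective (a.shift t) ⟨a.shift_injective t ht, a.shift_surjective t ht⟩
  let T₀ : H →ₗ[ℂ] H := ((t : ℂ) • a.op.toFun).comp e.symm.toLinearMap
  have hT₀ : ∀ x, T₀ (a.shift t x) = (t : ℂ) • a.op x := by
    intro x
    have : e.symm (a.shift t x) = x := e.symm_apply_apply x
    simp only [T₀, LinearMap.comp_apply, LinearEquiv.coe_coe, this]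
    rfl
  refine ⟨T₀.mkContinuous (t * 2) fun y => ?_, fun x => hT₀ x⟩
  obtain ⟨x, rfl⟩ := a.shift_surjective t ht y
  rw [hT₀, norm_smul, Complex.norm_real, Real.norm_of_nonneg ht.le, mul_assoc]
  exact mul_le_mul_of_nonneg_left (a.norm_op_le t ht x) ht.le

open Classical in
/-- The bounded operator `a_t`, the closure of `t a (t + a)⁻¹`, for `t > 0`: it is the only bounded
operator which maps `t x + a x` to `t a x` for all `x` in the domain of `a`.
(For `t ≤ 0` it is `0` by convention; only `t → +∞` and `t = 1` matter.) -/
noncomputable def yosida (t : ℝ) : H →L[ℂ] H :=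
  if ht : 0 < t then (a.exists_yosida t ht).choose else 0

theorem yosida_apply (t : ℝ) (ht : 0 < t) (x : a.op.domain) :
    a.yosida t ((t : ℂ) • (x : H) + a.op x) = (t : ℂ) • a.op x := by
  rw [yosida, dif_pos ht]
  exact (a.exists_yosida t ht).choose_spec x

theorem ext_shift (t : ℝ) (ht : 0 < t) {S T : H →L[ℂ] H}
    (h : ∀ x : a.op.domain, S ((t : ℂ) • (x : H) + a.op x) = T ((t : ℂ) • (x : H) + a.op x)) :
    S = T := by
  ext y
  obtain ⟨x, rfl⟩ := a.shift_surjective t ht y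
  exact h x

theorem yosida_nonneg (t : ℝ) : 0 ≤ a.yosida t := by
  by_cases ht : 0 < t
  swap
  · rw [yosida, dif_neg ht]
  rw [ContinuousLinearMap.nonneg_iff_isPositive, ContinuousLinearMap.isPositive_iff_complex]
  intro y
  obtain ⟨x, rfl⟩ := a.shift_surjective t ht y
  have h : 0 ≤ ⟪a.yosida t (a.shift t x), a.shift t x⟫_ℂ := by
    rw [shift_apply, a.yosida_apply t ht, inner_add_right, inner_smul_left, inner_smul_left,
      inner_smul_right, inner_self_eq_norm_sq_to_K, Complex.conj_ofReal]
    have h1 := a.nonneg x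
    have h2 : (0 : ℂ) ≤ (t : ℂ) := by exact_mod_cast ht.le
    have h3 : (0 : ℂ) ≤ ((‖a.op x‖ : ℝ) : ℂ) ^ 2 := by norm_cast; positivity
    exact add_nonneg (mul_nonneg h2 (mul_nonneg h2 h1)) (mul_nonneg h2 h3)
  obtain ⟨h1, h2⟩ := Complex.le_def.1 h
  exact ⟨Complex.ext (by simp) (by rw [Complex.ofReal_im]; exact h2), h1⟩

theorem yosida_one_le : a.yosida 1 ≤ 1 := by
  rw [← sub_nonneg, ContinuousLinearMap.nonneg_iff_isPositive,
    ContinuousLinearMap.isPositive_iff_complex]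
  intro y
  obtain ⟨x, rfl⟩ := a.shift_surjective 1 one_pos y
  have h : 0 ≤ ⟪(1 - a.yosida 1) (a.shift 1 x), a.shift 1 x⟫_ℂ := by
    have h0 : (1 - a.yosida 1) (a.shift 1 x) = x := by
      rw [sub_apply, shift_apply, a.yosida_apply 1 one_pos]
      simp
    rw [h0, shift_apply, inner_add_right, inner_smul_right, inner_self_eq_norm_sq_to_K,
      ← a.symm_op]
    have h1 := a.nonneg x
    have h3 : (0 : ℂ) ≤ ((‖(x : H)‖ : ℝ) : ℂ) ^ 2 := by norm_cast; positivity
    refine add_nonneg ?_ h1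
    rw [Complex.ofReal_one, one_mul]; exact h3
  obtain ⟨h1, h2⟩ := Complex.le_def.1 h
  exact ⟨Complex.ext (by simp) (by rw [Complex.ofReal_im]; exact h2), h1⟩

theorem mem_of_commute_unitary {T : H →L[ℂ] H}
    (hT : ∀ u ∈ unitary (H →L[ℂ] H), u ∈ M.commutant → u * T = T * u) : T ∈ M := by
  rw [← M.commutant_commutant, VonNeumannAlgebra.mem_commutant_iff]
  have hcl : IsClosed (M.commutant.toStarSubalgebra : Set (H →L[ℂ] H)) := by
    rw [VonNeumannAlgebra.coe_toStarSubalgebra, VonNeumannAlgebra.coe_commutant]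
    exact Set.isClosed_centralizer _
  let _ : CStarAlgebra M.commutant.toStarSubalgebra :=
    StarSubalgebra.cstarAlgebra M.commutant.toStarSubalgebra (h_closed := hcl)
  intro g hg
  have hmem : (⟨g, hg⟩ : M.commutant.toStarSubalgebra) ∈
      Submodule.span ℂ (unitary M.commutant.toStarSubalgebra :
        Set M.commutant.toStarSubalgebra) := by
    rw [CStarAlgebra.span_unitary]; trivial
  have : ∀ z ∈ Submodule.span ℂ (unitary M.commutant.toStarSubalgebra :
        Set M.commutant.toStarSubalgebra),
      (z : H →L[ℂ] H) * T = T * z := by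
    intro z hz
    induction hz using Submodule.span_induction with
    | mem u hu =>
      refine hT u ?_ u.2
      rw [SetLike.mem_coe, Unitary.mem_iff] at hu
      rw [Unitary.mem_iff]
      exact ⟨congrArg Subtype.val hu.1, congrArg Subtype.val hu.2⟩
    | zero => simp
    | add p q _ _ hp hq => simp [add_mul, mul_add, hp, hq]
    | smul c p _ hp => simp [hp]
  exact this _ hmem

theorem yosida_mem (t : ℝ) : a.yosida t ∈ M := by
  by_cases ht : 0 < t
  swap
  · rw [yosida, dif_neg ht]; exact zero_mem M
  refine mem_of_commute_unitary fun u hu huM => ?_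
  refine a.ext_shift t ht fun x => ?_
  obtain ⟨h, hx⟩ := a.affiliated u hu huM x
  rw [mul_apply_eq_comp, mul_apply_eq_comp, a.yosida_apply t ht,
    map_add, map_smul, map_smul, ← hx]
  exact (a.yosida_apply t ht ⟨u x, h⟩).symm

theorem sqrt_mem {T : H →L[ℂ] H} (hT : T ∈ M) : CFC.sqrt T ∈ M := by
  rw [← M.commutant_commutant, VonNeumannAlgebra.mem_commutant_iff] at hT ⊢
  intro g hg
  have : Commute T g := (hT g hg).symm
  exact (this.cfcₙ_nnreal NNReal.sqrt).symm

/-- `a_t` as an element of `M`. -/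
noncomputable def yosidaM (t : ℝ) : M.toStarSubalgebra := ⟨a.yosida t, a.yosida_mem t⟩

/-- `a_t^{1/2}` as an element of `M`. -/
noncomputable def sqrtYosidaM (t : ℝ) : M.toStarSubalgebra :=
  ⟨CFC.sqrt (a.yosida t), sqrt_mem (a.yosida_mem t)⟩

theorem yosida_sub (s t : ℝ) (hs : 0 < s) (ht : 0 < t) :
    a.yosida t - a.yosida s = ((t - s) / (t * s) : ℂ) • (a.yosida t * a.yosida s) := by
  refine a.ext_shift s hs fun x => ?_
  have hs' : (s : ℂ) ≠ 0 := by exact_mod_cast hs.ne'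
  have ht' : (t : ℂ) ≠ 0 := by exact_mod_cast ht.ne'
  have h1 := a.yosida_apply t ht x
  rw [map_add, map_smul] at h1
  have h1' : a.yosida t (a.op x) = (t : ℂ) • a.op x - (t : ℂ) • a.yosida t x :=
    eq_sub_of_add_eq' h1
  rw [sub_apply, smul_apply,
    mul_apply_eq_comp, a.yosida_apply s hs, map_add, map_smul, map_smul, h1']
  have h2 : ((t - s) / (t * s) : ℂ) * s * t = t - s := by field_simp
  simp only [smul_sub, smul_smul, ← mul_assoc, h2]
  module

theorem yosida_commute (s t : ℝ) : Commute (a.yosida s) (a.yosida t) := by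
  by_cases hs : 0 < s
  swap
  · rw [yosida, dif_neg hs]; exact Commute.zero_left _
  by_cases ht : 0 < t
  swap
  · rw [yosida.eq_def a t, dif_neg ht]; exact Commute.zero_right _
  by_cases hst : s = t
  · rw [hst]
  have h1 := a.yosida_sub s t hs ht
  have h2 := a.yosida_sub t s ht hs
  have hc : ((t - s) / (t * s) : ℂ) ≠ 0 := by
    have hs' : (s : ℂ) ≠ 0 := by exact_mod_cast hs.ne'
    have ht' : (t : ℂ) ≠ 0 := by exact_mod_cast ht.ne'
    have : (t - s : ℂ) ≠ 0 := sub_ne_zero.2 (by exact_mod_cast Ne.symm hst)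
    positivity
  have h3 : ((t - s) / (t * s) : ℂ) • (a.yosida t * a.yosida s)
      = ((t - s) / (t * s) : ℂ) • (a.yosida s * a.yosida t) := by
    rw [← h1, ← neg_sub, h2, ← neg_smul]
    congr 1
    ring
  exact (smul_right_injective _ hc h3).symm

theorem sqrtYosida_mul_self (t : ℝ) :
    CFC.sqrt (a.yosida t) * CFC.sqrt (a.yosida t) = a.yosida t :=
  CFC.sqrt_mul_sqrt_self _ (a.yosida_nonneg t)

/-! ### The square root `a^{1/2}` -/

/-- The positive self-adjoint square root `a^{1/2}`. In terms of `b = a (1 + a)⁻¹` and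
`1 - b = (1 + a)⁻¹` it is `b^{1/2} ((1 - b)^{1/2})⁻¹`, with domain the range of `(1 - b)^{1/2}`;
see `sqrt_isSelfAdjoint`, `sqrt_nonneg` and `sqrt_sq`. -/
noncomputable def sqrt : H →ₗ.[ℂ] H :=
  (CFC.sqrt (a.yosida 1)).toLinearMap.compPMap
    ((CFC.sqrt (1 - a.yosida 1)).toLinearMap.toPMap ⊤).inverse

theorem sqrt_inj : Function.Injective (CFC.sqrt (1 - a.yosida 1) : H →L[ℂ] H) := by
  have hB2 : CFC.sqrt (1 - a.yosida 1) * CFC.sqrt (1 - a.yosida 1) = 1 - a.yosida 1 :=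
    CFC.sqrt_mul_sqrt_self _ (sub_nonneg.2 a.yosida_one_le)
  rw [injective_iff_map_eq_zero]
  intro y hy
  have h1 : (1 - a.yosida 1) y = 0 := by
    rw [← hB2, mul_apply_eq_comp, hy, map_zero]
  obtain ⟨x, rfl⟩ := a.shift_surjective 1 one_pos y
  have h0 : (1 - a.yosida 1) (a.shift 1 x) = x := by
    rw [sub_apply, shift_apply, a.yosida_apply 1 one_pos]
    simp
  rw [h0] at h1
  rw [show x = 0 from Subtype.ext h1, map_zero]

theorem mem_sqrt_domain (y : H) :
    y ∈ a.sqrt.domain ↔ ∃ x, CFC.sqrt (1 - a.yosida 1) x = y := by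
  change y ∈ LinearPMap.domain (LinearPMap.inverse _) ↔ _
  rw [LinearPMap.inverse_domain]
  constructor
  · rintro ⟨x, rfl⟩; exact ⟨x, rfl⟩
  · rintro ⟨x, rfl⟩; exact ⟨⟨x, trivial⟩, rfl⟩

/-- `a^{1/2}` maps `(1 - b)^{1/2} x` to `b^{1/2} x`, where `b = a (1 + a)⁻¹`. -/
theorem sqrt_apply (x : H) (h : CFC.sqrt (1 - a.yosida 1) x ∈ a.sqrt.domain) :
    a.sqrt ⟨CFC.sqrt (1 - a.yosida 1) x, h⟩ = CFC.sqrt (a.yosida 1) x := by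
  have hker : ((CFC.sqrt (1 - a.yosida 1)).toLinearMap.toPMap ⊤).toFun.ker = ⊥ := by
    rw [LinearMap.ker_eq_bot']
    intro z hz
    exact Subtype.ext ((injective_iff_map_eq_zero _).1 a.sqrt_inj _ hz)
  have := LinearPMap.inverse_apply_eq hker
    (y := ⟨CFC.sqrt (1 - a.yosida 1) x, h⟩) (x := ⟨x, trivial⟩) rfl
  exact congrArg (fun z => (CFC.sqrt (a.yosida 1) : H →L[ℂ] H) z) this

theorem sqrt_commute : Commute (CFC.sqrt (a.yosida 1)) (CFC.sqrt (1 - a.yosida 1)) := by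
  have h : Commute (a.yosida 1) (1 - a.yosida 1) :=
    (Commute.one_right _).sub_right (Commute.refl _)
  exact ((h.cfcₙ_nnreal NNReal.sqrt).symm.cfcₙ_nnreal NNReal.sqrt).symm

theorem sqrt_sq_add (x : H) : CFC.sqrt (a.yosida 1) (CFC.sqrt (a.yosida 1) x) +
    CFC.sqrt (1 - a.yosida 1) (CFC.sqrt (1 - a.yosida 1) x) = x := by
  rw [← mul_apply_eq_comp, ← mul_apply_eq_comp, a.sqrtYosida_mul_self,
    CFC.sqrt_mul_sqrt_self _ (sub_nonneg.2 a.yosida_one_le)]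
  simp

theorem sqrt_comm_apply (x : H) :
    CFC.sqrt (a.yosida 1) (CFC.sqrt (1 - a.yosida 1) x) =
      CFC.sqrt (1 - a.yosida 1) (CFC.sqrt (a.yosida 1) x) :=
  DFunLike.congr_fun a.sqrt_commute.eq x

theorem inner_sqrt_left (T : H →L[ℂ] H) (x y : H) :
    ⟪CFC.sqrt T x, y⟫_ℂ = ⟪x, CFC.sqrt T y⟫_ℂ :=
  (IsSelfAdjoint.of_nonneg (CFC.sqrt_nonneg T)).isSymmetric x y

theorem sqrt_nonneg (f : a.sqrt.domain) : 0 ≤ ⟪a.sqrt f, (f : H)⟫_ℂ := by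
  obtain ⟨f, hf⟩ := f
  obtain ⟨x, rfl⟩ := (a.mem_sqrt_domain f).1 hf
  rw [a.sqrt_apply, ← inner_sqrt_left, ← mul_apply_eq_comp]
  have h := Commute.mul_nonneg (CFC.sqrt_nonneg (1 - a.yosida 1)) (CFC.sqrt_nonneg (a.yosida 1))
    a.sqrt_commute.symm
  rw [ContinuousLinearMap.nonneg_iff_isPositive, ContinuousLinearMap.isPositive_iff_complex] at h
  obtain ⟨h1, h2⟩ := h x
  rw [← h1]
  exact_mod_cast h2

theorem sqrt_dense : Dense (a.sqrt.domain : Set H) := by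
  rw [Submodule.dense_iff_topologicalClosure_eq_top, Submodule.topologicalClosure_eq_top_iff,
    Submodule.eq_bot_iff]
  intro y hy
  refine (injective_iff_map_eq_zero _).1 a.sqrt_inj y ?_
  have := (Submodule.mem_orthogonal' _ _).1 hy
    (CFC.sqrt (1 - a.yosida 1) (CFC.sqrt (1 - a.yosida 1) y)) ((a.mem_sqrt_domain _).2 ⟨_, rfl⟩)
  rw [← inner_sqrt_left] at this
  exact inner_self_eq_zero.1 this

theorem sqrt_isSelfAdjoint : IsSelfAdjoint a.sqrt := by
  rw [LinearPMap.isSelfAdjoint_def]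
  refine le_antisymm ?_ ?_
  · refine LinearPMap.le_of_le_graph ?_
    rintro ⟨y, w⟩ hyw
    obtain ⟨y', hy1, hy2⟩ := (LinearPMap.mem_graph_iff _).1 hyw
    simp only at hy1 hy2
    subst hy1 hy2
    set w := a.sqrt.adjoint y' with hw
    have hadj : ∀ x : H, ⟪w, CFC.sqrt (1 - a.yosida 1) x⟫_ℂ = ⟪(y' : H), CFC.sqrt (a.yosida 1) x⟫_ℂ := by
      intro x
      have h := (a.mem_sqrt_domain _).2 ⟨x, rfl⟩
      have := LinearPMap.adjoint_isFormalAdjoint a.sqrt_dense y' ⟨_, h⟩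
      rwa [a.sqrt_apply] at this
    have hBC : CFC.sqrt (1 - a.yosida 1) w = CFC.sqrt (a.yosida 1) (y' : H) := by
      refine ext_inner_right ℂ fun x => ?_
      rw [inner_sqrt_left, inner_sqrt_left, hadj]
    have hy : CFC.sqrt (1 - a.yosida 1)
        (CFC.sqrt (a.yosida 1) w + CFC.sqrt (1 - a.yosida 1) (y' : H)) = y' := by
      rw [map_add, ← sqrt_comm_apply, hBC, sqrt_sq_add]
    have hdom := (a.mem_sqrt_domain _).2 ⟨_, hy⟩
    refine (LinearPMap.mem_graph_iff _).2 ⟨⟨y', hdom⟩, rfl, ?_⟩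
    have h2 : a.sqrt ⟨y', hdom⟩ =
        CFC.sqrt (a.yosida 1) (CFC.sqrt (a.yosida 1) w + CFC.sqrt (1 - a.yosida 1) (y' : H)) := by
      rw [← a.sqrt_apply _ ((a.mem_sqrt_domain _).2 ⟨_, rfl⟩)]
      congr 1
      exact Subtype.ext hy.symm
    rw [h2, map_add, sqrt_comm_apply, ← hBC, sqrt_sq_add]
  · refine LinearPMap.IsFormalAdjoint.le_adjoint a.sqrt_dense fun f g => ?_
    obtain ⟨f, hf⟩ := f
    obtain ⟨g, hg⟩ := g
    obtain ⟨x, rfl⟩ := (a.mem_sqrt_domain f).1 hf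
    obtain ⟨y, rfl⟩ := (a.mem_sqrt_domain g).1 hg
    rw [a.sqrt_apply, a.sqrt_apply, inner_sqrt_left, inner_sqrt_left, sqrt_comm_apply]

/-- `a^{1/2} a^{1/2} = a`, as unbounded operators with their natural domains. -/
theorem sqrt_sq (x y : H) : (∃ h : x ∈ a.op.domain, a.op ⟨x, h⟩ = y) ↔
    ∃ (h : x ∈ a.sqrt.domain) (h' : a.sqrt ⟨x, h⟩ ∈ a.sqrt.domain), a.sqrt ⟨_, h'⟩ = y := by
  have hB2 : ∀ z : a.op.domain, CFC.sqrt (1 - a.yosida 1) (CFC.sqrt (1 - a.yosida 1)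
      (a.shift 1 z)) = z := by
    intro z
    rw [← mul_apply_eq_comp, CFC.sqrt_mul_sqrt_self _ (sub_nonneg.2 a.yosida_one_le),
      sub_apply, shift_apply, a.yosida_apply 1 one_pos]
    simp
  have key : ∀ z : a.op.domain, ∃ (h : (z : H) ∈ a.sqrt.domain)
      (h' : a.sqrt ⟨z, h⟩ ∈ a.sqrt.domain), a.sqrt ⟨_, h'⟩ = a.op z := by
    intro z
    have h := (a.mem_sqrt_domain z).2 ⟨_, hB2 z⟩
    have h1 : a.sqrt ⟨z, h⟩ = CFC.sqrt (1 - a.yosida 1)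
        (CFC.sqrt (a.yosida 1) (a.shift 1 z)) := by
      rw [← sqrt_comm_apply, ← a.sqrt_apply _ ((a.mem_sqrt_domain _).2 ⟨_, rfl⟩)]
      congr 1
      exact Subtype.ext (hB2 z).symm
    have h' := (a.mem_sqrt_domain _).2 ⟨_, h1.symm⟩
    refine ⟨h, h', ?_⟩
    have h2 : a.sqrt ⟨_, h'⟩ = CFC.sqrt (a.yosida 1)
        (CFC.sqrt (a.yosida 1) (a.shift 1 z)) := by
      rw [← a.sqrt_apply _ ((a.mem_sqrt_domain _).2 ⟨_, rfl⟩)]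
      congr 1
      exact Subtype.ext h1
    rw [h2, ← mul_apply_eq_comp, sqrtYosida_mul_self, shift_apply,
      a.yosida_apply 1 one_pos]
    simp
  constructor
  · rintro ⟨h, rfl⟩
    exact key ⟨x, h⟩
  · rintro ⟨h, h', rfl⟩
    obtain ⟨u, rfl⟩ := (a.mem_sqrt_domain x).1 h
    have h1 : a.sqrt ⟨_, h⟩ = CFC.sqrt (a.yosida 1) u := a.sqrt_apply u h
    obtain ⟨v, hv⟩ := (a.mem_sqrt_domain _).1 h'
    rw [h1] at hv
    obtain ⟨z, hz⟩ := a.shift_surjective 1 one_pos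
      (CFC.sqrt (a.yosida 1) v + CFC.sqrt (1 - a.yosida 1) u)
    have hu : CFC.sqrt (1 - a.yosida 1) (a.shift 1 z) = u := by
      rw [hz, map_add, ← sqrt_comm_apply, hv, sqrt_sq_add]
    have hzx : (z : H) = CFC.sqrt (1 - a.yosida 1) u := by rw [← hu, hB2]
    refine ⟨hzx ▸ z.2, ?_⟩
    obtain ⟨k, k', hk⟩ := key z
    have e1 : (⟨CFC.sqrt (1 - a.yosida 1) u, hzx ▸ z.2⟩ : a.op.domain) = z := Subtype.ext hzx.symm
    rw [e1, ← hk]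
    congr 1
    refine Subtype.ext ?_
    simp only
    congr 1
    exact Subtype.ext hzx

/-! ### Normal functionals, `φ(a)`, and `𝔇_a^h` with its seminorm -/

/-- Ultraweakly continuous linear functionals on `M`, the elements of the predual `M_*`: those of
the form `x ↦ ∑ ⟨x fᵢ, gᵢ⟩` with `∑ ‖fᵢ‖² < ∞` and `∑ ‖gᵢ‖² < ∞`. -/
def _root_.VonNeumannAlgebra.IsNormalFunctional (M : VonNeumannAlgebra H)
    (φ : M.toStarSubalgebra →ₗ[ℂ] ℂ) : Prop :=
  ∃ f g : ℕ → H, Summable (fun i => ‖f i‖ ^ 2) ∧ Summable (fun i => ‖g i‖ ^ 2) ∧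
    ∀ x : M.toStarSubalgebra, HasSum (fun i => ⟪g i, (x : H →L[ℂ] H) (f i)⟫_ℂ) (φ x)

/-- The cone `M_*^+` of positive ultraweakly continuous functionals. -/
def _root_.VonNeumannAlgebra.predualPos (M : VonNeumannAlgebra H) :
    Set (M.toStarSubalgebra →ₗ[ℂ] ℂ) :=
  {φ | M.IsNormalFunctional φ ∧ ∀ x : M.toStarSubalgebra, 0 ≤ φ (star x * x)}

/-- `φ(a) = lim_{t → +∞} φ(a_t)`, in `[0, ∞]`; intended for `φ ∈ M_*^+`, where the limit exists by
monotonicity, see `tendsto_eval`. -/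
noncomputable def eval (φ : M.toStarSubalgebra →ₗ[ℂ] ℂ) : ℝ≥0∞ :=
  limUnder atTop fun t : ℝ => ENNReal.ofReal (φ (a.yosidaM t)).re

/-- `𝔇_a^+`. -/
def domPos : Set (M.toStarSubalgebra →ₗ[ℂ] ℂ) := {φ | φ ∈ M.predualPos ∧ a.eval φ < ∞}

theorem star_sqrtYosidaM (t : ℝ) : star (a.sqrtYosidaM t) = a.sqrtYosidaM t :=
  Subtype.ext (IsSelfAdjoint.of_nonneg (CFC.sqrt_nonneg (a.yosida t))).star_eq

theorem monotone_eval {φ : M.toStarSubalgebra →ₗ[ℂ] ℂ} (hφ : φ ∈ M.predualPos) {s t : ℝ}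
    (hs : 0 < s) (hst : s ≤ t) : (φ (a.yosidaM s)).re ≤ (φ (a.yosidaM t)).re := by
  have ht := hs.trans_le hst
  have h1 := hφ.2 (a.sqrtYosidaM s * a.sqrtYosidaM t)
  have h2 : star (a.sqrtYosidaM s * a.sqrtYosidaM t) * (a.sqrtYosidaM s * a.sqrtYosidaM t) =
      a.yosidaM t * a.yosidaM s := by
    rw [star_mul, star_sqrtYosidaM, star_sqrtYosidaM]
    refine Subtype.ext ?_
    change CFC.sqrt (a.yosida t) * CFC.sqrt (a.yosida s) *
      (CFC.sqrt (a.yosida s) * CFC.sqrt (a.yosida t)) = a.yosida t * a.yosida s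
    have hc : Commute (CFC.sqrt (a.yosida t)) (a.yosida s) :=
      (a.yosida_commute t s).cfcₙ_nnreal NNReal.sqrt
    rw [mul_assoc, ← mul_assoc (CFC.sqrt (a.yosida s)), sqrtYosida_mul_self, ← hc.eq, ← mul_assoc,
      sqrtYosida_mul_self]
  rw [h2] at h1
  have h3 : a.yosidaM t - a.yosidaM s = ((t - s) / (t * s) : ℂ) • (a.yosidaM t * a.yosidaM s) :=
    Subtype.ext (a.yosida_sub s t hs ht)
  have h4 := congrArg φ h3
  rw [map_sub, map_smul, smul_eq_mul] at h4
  have hc : (0 : ℂ) ≤ ((t - s) / (t * s) : ℂ) := by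
    have : 0 ≤ (t - s) / (t * s) := div_nonneg (sub_nonneg.2 hst) (by positivity)
    exact_mod_cast this
  have h5 := (Complex.le_def.1 (h4 ▸ mul_nonneg hc h1)).1
  rw [Complex.sub_re, Complex.zero_re] at h5
  linarith

theorem tendsto_eval {φ : M.toStarSubalgebra →ₗ[ℂ] ℂ} (hφ : φ ∈ M.predualPos) :
    Tendsto (fun t : ℝ => ENNReal.ofReal (φ (a.yosidaM t)).re) atTop (𝓝 (a.eval φ)) := by
  refine tendsto_nhds_limUnder ?_
  let F : ℝ → ℝ≥0∞ := fun t => ENNReal.ofReal (φ (a.yosidaM (max t 1))).re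
  have hF : Monotone F := fun s t hst => ENNReal.ofReal_le_ofReal
    (a.monotone_eval hφ (lt_max_of_lt_right one_pos) (max_le_max_right 1 hst))
  refine ⟨_, (tendsto_atTop_iSup hF).congr' ?_⟩
  filter_upwards [eventually_ge_atTop 1] with t ht
  simp only [F, max_eq_left ht]

theorem predualPos_add {φ ψ : M.toStarSubalgebra →ₗ[ℂ] ℂ} (hφ : φ ∈ M.predualPos)
    (hψ : ψ ∈ M.predualPos) : φ + ψ ∈ M.predualPos := by
  obtain ⟨⟨f, g, hf, hg, h⟩, hp⟩ := hφ
  obtain ⟨⟨f', g', hf', hg', h'⟩, hp'⟩ := hψ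
  refine ⟨?_, fun x => add_nonneg (hp x) (hp' x)⟩
  let e : ℕ ≃ ℕ ⊕ ℕ := Equiv.natSumNatEquivNat.symm
  refine ⟨fun i => Sum.elim f f' (e i), fun i => Sum.elim g g' (e i), ?_, ?_, fun x => ?_⟩
  · exact (e.summable_iff (f := fun j => ‖Sum.elim f f' j‖ ^ 2)).2 (Summable.sum _ hf hf')
  · exact (e.summable_iff (f := fun j => ‖Sum.elim g g' j‖ ^ 2)).2 (Summable.sum _ hg hg')
  · exact (e.hasSum_iff (f := fun j => ⟪Sum.elim g g' j,
      (x : H →L[ℂ] H) (Sum.elim f f' j)⟫_ℂ)).2 (HasSum.sum (h x) (h' x))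

theorem predualPos_smul {φ : M.toStarSubalgebra →ₗ[ℂ] ℂ} (hφ : φ ∈ M.predualPos) {r : ℝ}
    (hr : 0 ≤ r) : r • φ ∈ M.predualPos := by
  obtain ⟨⟨f, g, hf, hg, h⟩, hp⟩ := hφ
  refine ⟨⟨fun i => (r : ℂ) • f i, g, ?_, hg, fun x => ?_⟩, fun x => ?_⟩
  · simpa [norm_smul, mul_pow] using hf.mul_left (r ^ 2)
  · simpa [inner_smul_right] using (h x).mul_left (r : ℂ)
  · rw [LinearMap.smul_apply, Complex.real_smul]
    exact mul_nonneg (by exact_mod_cast hr) (hp x)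

theorem zero_mem_predualPos : (0 : M.toStarSubalgebra →ₗ[ℂ] ℂ) ∈ M.predualPos :=
  ⟨⟨0, 0, by simp, by simp, fun x => by simp⟩, fun x => le_rfl⟩

theorem yosidaM_nonneg {φ : M.toStarSubalgebra →ₗ[ℂ] ℂ} (hφ : φ ∈ M.predualPos) (t : ℝ) :
    0 ≤ (φ (a.yosidaM t)).re := by
  have h := hφ.2 (a.sqrtYosidaM t)
  rw [star_sqrtYosidaM] at h
  have h2 : a.sqrtYosidaM t * a.sqrtYosidaM t = a.yosidaM t := Subtype.ext (a.sqrtYosida_mul_self t)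
  rw [h2] at h
  exact (Complex.le_def.1 h).1

theorem eval_add {φ ψ : M.toStarSubalgebra →ₗ[ℂ] ℂ} (hφ : φ ∈ M.predualPos)
    (hψ : ψ ∈ M.predualPos) : a.eval (φ + ψ) = a.eval φ + a.eval ψ := by
  refine tendsto_nhds_unique (a.tendsto_eval (predualPos_add hφ hψ)) ?_
  refine ((a.tendsto_eval hφ).add (a.tendsto_eval hψ)).congr fun t => ?_
  rw [LinearMap.add_apply, Complex.add_re,
    ENNReal.ofReal_add (a.yosidaM_nonneg hφ t) (a.yosidaM_nonneg hψ t)]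

theorem eval_smul {φ : M.toStarSubalgebra →ₗ[ℂ] ℂ} (hφ : φ ∈ M.predualPos) {r : ℝ}
    (hr : 0 ≤ r) : a.eval (r • φ) = ENNReal.ofReal r * a.eval φ := by
  refine tendsto_nhds_unique (a.tendsto_eval (predualPos_smul hφ hr)) ?_
  refine (ENNReal.Tendsto.const_mul (a.tendsto_eval hφ) (Or.inr ENNReal.ofReal_ne_top)).congr
    fun t => ?_
  rw [← ENNReal.ofReal_mul hr, LinearMap.smul_apply, Complex.smul_re, smul_eq_mul]

theorem domPos_add {φ ψ : M.toStarSubalgebra →ₗ[ℂ] ℂ} (hφ : φ ∈ a.domPos) (hψ : ψ ∈ a.domPos) :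
    φ + ψ ∈ a.domPos :=
  ⟨predualPos_add hφ.1 hψ.1, by
    rw [a.eval_add hφ.1 hψ.1]; exact ENNReal.add_lt_top.2 ⟨hφ.2, hψ.2⟩⟩

theorem domPos_smul {φ : M.toStarSubalgebra →ₗ[ℂ] ℂ} (hφ : φ ∈ a.domPos) {r : ℝ} (hr : 0 ≤ r) :
    r • φ ∈ a.domPos :=
  ⟨predualPos_smul hφ.1 hr, by
    rw [a.eval_smul hφ.1 hr]; exact ENNReal.mul_lt_top ENNReal.ofReal_lt_top hφ.2⟩

theorem zero_mem_domPos : (0 : M.toStarSubalgebra →ₗ[ℂ] ℂ) ∈ a.domPos :=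
  ⟨zero_mem_predualPos, by
    have := a.eval_smul (zero_mem_predualPos (M := M)) le_rfl
    rw [zero_smul, ENNReal.ofReal_zero, zero_mul] at this
    rw [this]; exact ENNReal.zero_lt_top⟩

/-- The real vector space `𝔇_a^h = 𝔇_a^+ - 𝔇_a^+`. -/
def domH : Submodule ℝ (M.toStarSubalgebra →ₗ[ℂ] ℂ) where
  carrier := {φ | ∃ φ₁ ∈ a.domPos, ∃ φ₂ ∈ a.domPos, φ = φ₁ - φ₂}
  zero_mem' := ⟨0, a.zero_mem_domPos, 0, a.zero_mem_domPos, by simp⟩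
  add_mem' := by
    rintro _ _ ⟨φ₁, h₁, φ₂, h₂, rfl⟩ ⟨ψ₁, k₁, ψ₂, k₂, rfl⟩
    exact ⟨_, a.domPos_add h₁ k₁, _, a.domPos_add h₂ k₂, by abel⟩
  smul_mem' := by
    rintro r _ ⟨φ₁, h₁, φ₂, h₂, rfl⟩
    rcases le_total 0 r with hr | hr
    · exact ⟨_, a.domPos_smul h₁ hr, _, a.domPos_smul h₂ hr, smul_sub _ _ _⟩
    · refine ⟨_, a.domPos_smul h₂ (neg_nonneg.2 hr), _, a.domPos_smul h₁ (neg_nonneg.2 hr), ?_⟩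
      module

theorem domPos_subset {φ : M.toStarSubalgebra →ₗ[ℂ] ℂ} (hφ : φ ∈ a.domPos) : φ ∈ a.domH :=
  ⟨φ, hφ, 0, a.zero_mem_domPos, (sub_zero φ).symm⟩

/-- The seminorm `‖φ‖_a = inf {φ₁(a) + φ₂(a) | φ = φ₁ - φ₂, φ₁, φ₂ ∈ 𝔇_a^+}` on `𝔇_a^h`. -/
noncomputable def aNorm (φ : a.domH) : ℝ :=
  sInf {r : ℝ | ∃ φ₁ ∈ a.domPos, ∃ φ₂ ∈ a.domPos,
    (φ : M.toStarSubalgebra →ₗ[ℂ] ℂ) = φ₁ - φ₂ ∧ r = (a.eval φ₁).toReal + (a.eval φ₂).toReal}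

/-! ### The space `L_∞^{sa}(a)` -/

/-- `-r a ≤ ℓ ≤ r a` in the algebraic dual of `𝔇_a^h`, ordered by its values on `𝔇_a^+`. -/
def IsBetween (ℓ : Module.Dual ℝ a.domH) (r : ℝ) : Prop :=
  ∀ φ (hφ : φ ∈ a.domPos), -(r * (a.eval φ).toReal) ≤ ℓ ⟨φ, a.domPos_subset hφ⟩ ∧
    ℓ ⟨φ, a.domPos_subset hφ⟩ ≤ r * (a.eval φ).toReal

/-- The real vector space `L_∞^{sa}(a)` of all `ℓ` in the algebraic dual of `𝔇_a^h` with
`-r a ≤ ℓ ≤ r a` for some real `r`. -/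
def LInftySA : Submodule ℝ (Module.Dual ℝ a.domH) where
  carrier := {ℓ | ∃ r : ℝ, a.IsBetween ℓ r}
  zero_mem' := ⟨0, fun φ hφ => by simp⟩
  add_mem' := by
    rintro ℓ ℓ' ⟨r, hr⟩ ⟨r', hr'⟩
    refine ⟨r + r', fun φ hφ => ?_⟩
    have h1 := hr φ hφ
    have h2 := hr' φ hφ
    rw [LinearMap.add_apply, add_mul]
    constructor <;> linarith [h1.1, h1.2, h2.1, h2.2]
  smul_mem' := by
    rintro c ℓ ⟨r, hr⟩
    refine ⟨|c| * r, fun φ hφ => ?_⟩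
    have h1 := abs_le.2 (hr φ hφ)
    rw [LinearMap.smul_apply, smul_eq_mul, ← abs_le, abs_mul, mul_assoc]
    exact mul_le_mul_of_nonneg_left h1 (abs_nonneg c)

/-- The norm `‖ℓ‖^a = inf {r ≥ 0 | -r a ≤ ℓ ≤ r a}`. (If `H ≠ 0` and `a` is injective, only
`r ≥ 0` can occur, so that the restriction to `r ≥ 0` matters only if `H = 0`.) -/
noncomputable def linftyNorm (ℓ : Module.Dual ℝ a.domH) : ℝ :=
  sInf {r : ℝ | 0 ≤ r ∧ a.IsBetween ℓ r}

/-! ### The sesquilinear forms `(f, g) ↦ ⟨x a^{1/2} f, a^{1/2} g⟩` -/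

/-- Sesquilinear forms on `D(a^{1/2})`, linear in the first and conjugate-linear in the second
variable. -/
abbrev Form : Type _ := a.sqrt.domain →ₗ[ℂ] a.sqrt.domain →ₗ⋆[ℂ] ℂ

/-- The form `(f, g) ↦ ⟨x a^{1/2} f, a^{1/2} g⟩` of `x ∈ M`. (Mathlib's inner product is
conjugate-linear in its first argument, hence the order of the arguments.) -/
noncomputable def form (x : M.toStarSubalgebra) : a.Form :=
  LinearMap.mk₂'ₛₗ (RingHom.id ℂ) (starRingEnd ℂ)
    (fun f g => ⟪a.sqrt g, (x : H →L[ℂ] H) (a.sqrt f)⟫_ℂ)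
    (fun f f' g => by rw [LinearPMap.map_add, map_add, inner_add_right])
    (fun c f g => by rw [LinearPMap.map_smul, map_smul, inner_smul_right]; rfl)
    (fun f g g' => by rw [LinearPMap.map_add, inner_add_left])
    (fun c f g => by rw [LinearPMap.map_smul, inner_smul_left]; rfl)

/-- The real vector space `S_a(M^{sa})` of the forms of self-adjoint `x ∈ M`. -/
noncomputable def formsSA : Submodule ℝ a.Form where
  carrier := {B | ∃ x : M.toStarSubalgebra, IsSelfAdjoint x ∧ B = a.form x}
  zero_mem' := ⟨0, IsSelfAdjoint.zero _, by ext f g; simp [form]⟩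
  add_mem' := by
    rintro _ _ ⟨x, hx, rfl⟩ ⟨y, hy, rfl⟩
    exact ⟨x + y, hx.add hy, by ext f g; simp [form]⟩
  smul_mem' := by
    rintro r _ ⟨x, hx, rfl⟩
    refine ⟨(r : ℂ) • x, ?_, ?_⟩
    · rw [IsSelfAdjoint, star_smul, hx.star_eq]; simp
    · ext f g; simp [form]

/-- The form of a self-adjoint `x ∈ M` as an element of `S_a(M^{sa})`. -/
noncomputable def formSA (x : selfAdjoint M.toStarSubalgebra) : a.formsSA :=
  ⟨a.form x, x, x.2, rfl⟩

/-- The seminorm `p_a(B) = inf {r ≥ 0 | -r I ≤ B ≤ r I}` where `I` is the form of the identity and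
forms are compared by their values at the pairs `(f, f)`. -/
noncomputable def formSeminorm (B : a.formsSA) : ℝ :=
  sInf {r : ℝ | 0 ≤ r ∧ ∀ f : a.sqrt.domain,
    -(r : ℂ) * a.form 1 f f ≤ (B : a.Form) f f ∧ (B : a.Form) f f ≤ (r : ℂ) * a.form 1 f f}

end PosAffiliated

/-! The duality in (1) is formal. A bound `-r a ≤ ℓ ≤ r a` gives `|ℓ φ| ≤ r (φ₁(a) + φ₂(a))` for
every decomposition `φ = φ₁ - φ₂`, hence for the infimum. Conversely `‖φ‖_a ≤ φ(a)` on `𝔇_a^+`. So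
both norms of `ℓ` are infima of one and the same set.

For (2) everything is reduced to vectors. A positive normal functional is a sum of vector
functionals of some `f i` (`exists_hasSum_of_mem_predualPos`): it is dominated by a vector
functional of the amplification of `M` to `ℓ²(H)`, and a Radon-Nikodym argument applies on a cyclic
subspace. If `φ(a) < ∞`, then `∑ ‖a_t^{1/2} f i‖² = φ(a_t)` stays bounded, so that `f i ∈
D(a^{1/2})` and `∑ ‖a^{1/2} f i‖² = φ(a)` (`exists_isVectorSum`, `IsVectorSum.toReal_eval`). By
dominated convergence `φ(a_t^{1/2} x a_t^{1/2})` tends to `∑ ⟨x a^{1/2} f i, a^{1/2} f i⟩`. Hence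
the order bounds on the limit functional of `x` are exactly those on its form, which gives equality
of the norms.

For surjectivity, the values of `ℓ` at vector functionals are polarised to a sesquilinear form on
`D(a^{1/2})`, bounded by `‖a^{1/2} f‖²` on the diagonal. As `a` is injective, `a^{1/2}` has dense
range, and the form is `⟨a^{1/2} f, x a^{1/2} g⟩` for a bounded `x`. Vector functionals on `M` are
invariant under unitaries of the commutant, so `x ∈ M`. Finally `ℓ` is determined by its vector
values, because the tails of a vector sum have small value at `a` (`eq_zero_of_vectorFunctional`).
-/

/-! ### Bounded sesquilinear forms -/

section BoundedForm

variable {E K : Type*} [AddCommGroup E] [Module ℂ E] [NormedAddCommGroup K]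
  [InnerProductSpace ℂ K]

/-- Polarisation writes `4 B e f` with four diagonal values; the parallelogram law for `(j e, j f)`
and for `(j e, i j f)` adds up their bounds. No symmetry of `B` is needed. -/
theorem norm_form_le_add_sq (j : E →ₗ[ℂ] K) (B : E →ₗ⋆[ℂ] E →ₗ[ℂ] ℂ) {r : ℝ}
    (hB : ∀ e, ‖B e e‖ ≤ r * ‖j e‖ ^ 2) (e f : E) :
    ‖B e f‖ ≤ r * (‖j e‖ ^ 2 + ‖j f‖ ^ 2) := by
  have key : 4 * B e f = B (e + f) (e + f) - B (e - f) (e - f)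
      - Complex.I * B (e + Complex.I • f) (e + Complex.I • f)
      + Complex.I * B (e - Complex.I • f) (e - Complex.I • f) := by
    simp only [map_add, map_sub, LinearMap.add_apply, LinearMap.sub_apply, map_smul,
      LinearMap.map_smulₛₗ, LinearMap.smul_apply, smul_eq_mul, Complex.conj_I]
    linear_combination (2 * B e f - 2 * B f e) * Complex.I_sq
  have h1 := parallelogram_law_with_norm ℂ (j e) (j f)
  have h2 := parallelogram_law_with_norm ℂ (j e) (Complex.I • j f)
  rw [norm_smul, Complex.norm_I, one_mul] at h2
  have a1 := hB (e + f)
  have a2 := hB (e - f)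
  have a3 := hB (e + Complex.I • f)
  have a4 := hB (e - Complex.I • f)
  rw [map_add j, pow_two] at a1 a3
  rw [map_sub j, pow_two] at a2 a4
  rw [map_smul j] at a3 a4
  have h3 : ‖4 * B e f‖ ≤ ‖B (e + f) (e + f)‖ + ‖B (e - f) (e - f)‖
      + ‖B (e + Complex.I • f) (e + Complex.I • f)‖
      + ‖B (e - Complex.I • f) (e - Complex.I • f)‖ := by
    rw [key]
    refine (norm_add_le _ _).trans (add_le_add ((norm_sub_le _ _).trans
      (add_le_add (norm_sub_le _ _) ?_)) ?_) <;> simp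
  rw [norm_mul, Complex.norm_ofNat] at h3
  have h4 : r * (‖j e + j f‖ * ‖j e + j f‖) + r * (‖j e - j f‖ * ‖j e - j f‖)
      + r * (‖j e + Complex.I • j f‖ * ‖j e + Complex.I • j f‖)
      + r * (‖j e - Complex.I • j f‖ * ‖j e - Complex.I • j f‖)
      = 4 * (r * (‖j e‖ ^ 2 + ‖j f‖ ^ 2)) := by
    linear_combination r * h1 + r * h2
  linarith

/-- Replacing `(e, f)` by `(s e, s⁻¹ f)` leaves `B e f` unchanged, and `s² = ‖j f‖ / ‖j e‖` balances
the two squares. The `ε` keeps `s` defined and positive when one of the norms vanishes. -/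
theorem norm_form_le_mul (j : E →ₗ[ℂ] K) (B : E →ₗ⋆[ℂ] E →ₗ[ℂ] ℂ) {r : ℝ} (hr : 0 ≤ r)
    (hB : ∀ e, ‖B e e‖ ≤ r * ‖j e‖ ^ 2) (e f : E) :
    ‖B e f‖ ≤ 2 * r * ‖j e‖ * ‖j f‖ := by
  have h : ∀ ε : ℝ, 0 < ε → ‖B e f‖ ≤ 2 * r * (‖j e‖ + ε) * (‖j f‖ + ε) := by
    intro ε hε
    have hp : 0 < ‖j e‖ + ε := by positivity
    have hq : 0 < ‖j f‖ + ε := by positivity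
    set s : ℝ := √((‖j f‖ + ε) / (‖j e‖ + ε)) with hs
    have hs0 : 0 < s := Real.sqrt_pos.2 (by positivity)
    have hs2 : s ^ 2 = (‖j f‖ + ε) / (‖j e‖ + ε) := Real.sq_sqrt (by positivity)
    have h1 := norm_form_le_add_sq j B hB ((s : ℂ) • e) ((s⁻¹ : ℂ) • f)
    have h2 : B ((s : ℂ) • e) ((s⁻¹ : ℂ) • f) = B e f := by
      have : (s : ℂ) ≠ 0 := by exact_mod_cast hs0.ne'
      rw [LinearMap.map_smul, LinearMap.map_smulₛₗ, LinearMap.smul_apply, smul_eq_mul, smul_eq_mul,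
        Complex.conj_ofReal, inv_mul_cancel_left₀ this]
    rw [h2, LinearMap.map_smul, LinearMap.map_smul, norm_smul, norm_smul, norm_inv, Complex.norm_real,
      Real.norm_of_nonneg hs0.le, mul_pow, mul_pow, inv_pow, hs2] at h1
    refine h1.trans ?_
    have h3 : (‖j f‖ + ε) / (‖j e‖ + ε) * ‖j e‖ ^ 2 ≤ (‖j f‖ + ε) * (‖j e‖ + ε) := by
      rw [div_mul_eq_mul_div, div_le_iff₀ hp, mul_assoc]
      refine mul_le_mul_of_nonneg_left ?_ hq.le
      nlinarith [norm_nonneg (j e)]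
    have h4 : ((‖j f‖ + ε) / (‖j e‖ + ε))⁻¹ * ‖j f‖ ^ 2 ≤ (‖j f‖ + ε) * (‖j e‖ + ε) := by
      rw [inv_div, div_mul_eq_mul_div, div_le_iff₀ hq, mul_comm (‖j f‖ + ε), mul_assoc]
      refine mul_le_mul_of_nonneg_left ?_ hp.le
      nlinarith [norm_nonneg (j f)]
    calc _ ≤ r * ((‖j f‖ + ε) * (‖j e‖ + ε) + (‖j f‖ + ε) * (‖j e‖ + ε)) :=
          mul_le_mul_of_nonneg_left (add_le_add h3 h4) hr
      _ = _ := by ring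
  have hc : Continuous fun ε : ℝ => 2 * r * (‖j e‖ + ε) * (‖j f‖ + ε) := by fun_prop
  have ht : Tendsto (fun ε : ℝ => 2 * r * (‖j e‖ + ε) * (‖j f‖ + ε)) (𝓝[>] 0)
      (𝓝 (2 * r * ‖j e‖ * ‖j f‖)) := by
    have := hc.tendsto 0
    simp only [add_zero] at this
    exact this.mono_left nhdsWithin_le_nhds
  exact ge_of_tendsto ht (by filter_upwards [self_mem_nhdsWithin] with ε hε using h ε hε)

/-- A sesquilinear form which is bounded with respect to the seminorm pulled back along a map with
dense range is given by a bounded operator. -/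
theorem exists_operator_of_bounded_form [CompleteSpace K] (j : E →ₗ[ℂ] K) (hj : DenseRange j)
    (B : E →ₗ⋆[ℂ] E →ₗ[ℂ] ℂ) {r : ℝ} (hr : 0 ≤ r) (hB : ∀ e, ‖B e e‖ ≤ r * ‖j e‖ ^ 2) :
    ∃ T : K →L[ℂ] K, ∀ e f, B e f = ⟪j e, T (j f)⟫_ℂ := by
  have hb := norm_form_le_mul j B hr hB
  -- Each `B e` factors through `j` and extends to `K`; its Riesz vector `v e` is linear in `e` and
  -- again bounded by `‖j e‖`. It therefore extends to an operator on `K`, whose adjoint is `T`.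
  let L : E → StrongDual ℂ K := fun e => (B e).extendOfNorm j
  have hL : ∀ e f, L e (j f) = B e f := fun e f =>
    LinearMap.extendOfNorm_eq hj ⟨_, hb e⟩ f
  have hLn : ∀ e, ‖L e‖ ≤ 2 * r * ‖j e‖ := fun e =>
    LinearMap.opNorm_extendOfNorm_le hj (by positivity) (hb e)
  let v : E → K := fun e => (InnerProductSpace.toDual ℂ K).symm (L e)
  have hv : ∀ e f, ⟪v e, j f⟫_ℂ = B e f := fun e f => by
    rw [InnerProductSpace.toDual_symm_apply, hL]
  have hext : ∀ x y : K, (∀ f, ⟪x, j f⟫_ℂ = ⟪y, j f⟫_ℂ) → x = y := by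
    intro x y h
    refine ext_inner_right ℂ fun z => ?_
    induction z using hj.induction_on with
    | hp => exact isClosed_eq (by fun_prop) (by fun_prop)
    | ih f => exact h f
  let v' : E →ₗ[ℂ] K :=
    { toFun := v
      map_add' := fun e e' => hext _ _ fun f => by
        rw [hv, inner_add_left, hv, hv, map_add, LinearMap.add_apply]
      map_smul' := fun c e => hext _ _ fun f => by
        rw [hv, RingHom.id_apply, inner_smul_left, hv, LinearMap.map_smulₛₗ, LinearMap.smul_apply,
          smul_eq_mul] }
  have hS : ∀ e, (v'.extendOfNorm j) (j e) = v e := fun e =>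
    LinearMap.extendOfNorm_eq hj ⟨2 * r, fun e => by
      change ‖(InnerProductSpace.toDual ℂ K).symm (L e)‖ ≤ _
      rw [LinearIsometryEquiv.norm_map]; exact hLn e⟩ e
  refine ⟨ContinuousLinearMap.adjoint (v'.extendOfNorm j), fun e f => ?_⟩
  rw [ContinuousLinearMap.adjoint_inner_right, hS, hv]

end BoundedForm

/-! ### Positive normal functionals as sums of vector functionals -/

/-- A positive functional which is dominated by the vector functional of a cyclic vector is itself
a vector functional. -/
theorem exists_vector_of_dominated {A V : Type*} [Ring A] [StarRing A] [Algebra ℂ A]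
    [StarModule ℂ A] [NormedAddCommGroup V] [InnerProductSpace ℂ V] [CompleteSpace V]
    (φ : A →ₗ[ℂ] ℂ) (hφ : ∀ x, 0 ≤ φ (star x * x)) (P : A → V →L[ℂ] V) (j : A →ₗ[ℂ] V)
    (hj : DenseRange j) (hPj : ∀ x y, P x (j y) = j (x * y))
    (hPstar : ∀ x v w, ⟪P (star x) v, w⟫_ℂ = ⟪v, P x w⟫_ℂ)
    (hdom : ∀ x, ‖φ (star x * x)‖ ≤ ‖j x‖ ^ 2) :
    ∃ w : V, ∀ x, φ x = ⟪w, P x w⟫_ℂ := by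
  let B : A →ₗ⋆[ℂ] A →ₗ[ℂ] ℂ :=
    LinearMap.mk₂'ₛₗ (starRingEnd ℂ) (RingHom.id ℂ) (fun x y => φ (star x * y))
      (fun x x' y => by rw [star_add, add_mul, map_add])
      (fun c x y => by rw [star_smul, smul_mul_assoc, map_smul]; rfl)
      (fun x y y' => by rw [mul_add, map_add])
      (fun c x y => by rw [mul_smul_comm, map_smul]; rfl)
  obtain ⟨T, hT⟩ := exists_operator_of_bounded_form j hj B zero_le_one fun x => by
    rw [one_mul]; exact hdom x
  have hT' : ∀ x y, φ (star x * y) = ⟪j x, T (j y)⟫_ℂ := hT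
  have hTnn : 0 ≤ T := by
    have h1 : ∀ v : V, 0 ≤ ⟪v, T v⟫_ℂ := by
      intro v
      induction v using hj.induction_on with
      | hp => exact isClosed_le (by fun_prop) (by fun_prop)
      | ih x => rw [← hT']; exact hφ x
    rw [ContinuousLinearMap.nonneg_iff_isPositive, ContinuousLinearMap.isPositive_iff_complex]
    intro v
    have h2 := h1 v
    change _ = ⟪T v, v⟫_ℂ ∧ 0 ≤ (⟪T v, v⟫_ℂ).re
    rw [← inner_conj_symm v] at h2
    obtain ⟨h3, h4⟩ := Complex.le_def.1 h2
    rw [Complex.conj_re] at h3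
    rw [Complex.conj_im] at h4
    refine ⟨Complex.ext (Complex.ofReal_re _) ?_, h3⟩
    rw [Complex.ofReal_im]
    exact (neg_eq_zero.1 h4.symm).symm
  -- Both products have the matrix coefficients `φ(y* x z)` on the dense range of `j`.
  have hcomm : ∀ x, Commute T (P x) := by
    intro x
    ext1 v
    induction v using hj.induction_on with
    | hp => exact isClosed_eq (by fun_prop) (by fun_prop)
    | ih z =>
      refine ext_inner_left ℂ fun w => ?_
      induction w using hj.induction_on with
      | hp => exact isClosed_eq (by fun_prop) (by fun_prop)
      | ih y =>
        rw [mul_apply_eq_comp, mul_apply_eq_comp, hPj, ← hT', ← hPstar, hPj, ← hT',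
          star_mul, star_star, mul_assoc]
  let S := CFC.sqrt T
  have hSS : S * S = T := CFC.sqrt_mul_sqrt_self T hTnn
  have hSsymm : ∀ v w, ⟪S v, w⟫_ℂ = ⟪v, S w⟫_ℂ := fun v w =>
    (IsSelfAdjoint.of_nonneg (CFC.sqrt_nonneg T)).isSymmetric v w
  have hScomm : ∀ x, Commute S (P x) := fun x => (hcomm x).cfcₙ_nnreal NNReal.sqrt
  -- `φ x = ⟨j 1, S² P x j 1⟩`, and one factor `S` moves to each side because `S` is symmetric and
  -- commutes with `P x`.
  refine ⟨S (j 1), fun x => ?_⟩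
  have h2 := hT' 1 (x * 1)
  rw [star_one, one_mul, mul_one] at h2
  have h3 : j x = P x (j 1) := by rw [hPj, mul_one]
  rw [h2, ← hSS, mul_apply_eq_comp, ← hSsymm, h3, ← mul_apply_eq_comp, (hScomm x).eq]
  rfl

namespace VonNeumannAlgebra

variable {H : Type*} [NormedAddCommGroup H] [InnerProductSpace ℂ H] [CompleteSpace H]
  {M : VonNeumannAlgebra H}

/-- A positive ultraweakly continuous functional is dominated by a sum of vector functionals. -/
theorem exists_dominating_of_mem_predualPos {φ : M.toStarSubalgebra →ₗ[ℂ] ℂ}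
    (hφ : φ ∈ M.predualPos) : ∃ h : ℕ → H, Summable (fun i => ‖h i‖ ^ 2) ∧
      ∀ x : M.toStarSubalgebra, ‖φ (star x * x)‖ ≤ ∑' i, ‖(x : H →L[ℂ] H) (h i)‖ ^ 2 := by
  obtain ⟨⟨f, g, hf, hg, h⟩, hp⟩ := hφ
  have hs : Summable (fun i => ‖f i + g i‖ ^ 2) := by
    refine Summable.of_nonneg_of_le (fun i => by positivity) (fun i => ?_)
      ((hf.add hg).mul_left 2)
    have := norm_add_le (f i) (g i)
    nlinarith [sq_nonneg (‖f i‖ - ‖g i‖), norm_nonneg (f i + g i)]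
  -- Since `φ(x* x)` is real, only `Re ⟨x g, x f⟩` matters, and `Re ⟨u, v⟩ ≤ ‖u + v‖²` for all
  -- vectors.
  refine ⟨fun i => f i + g i, hs, fun x => ?_⟩
  have hs' : Summable (fun i => ‖(x : H →L[ℂ] H) (f i + g i)‖ ^ 2) := by
    refine Summable.of_nonneg_of_le (fun i => by positivity) (fun i => ?_)
      (hs.mul_left (‖(x : H →L[ℂ] H)‖ ^ 2))
    rw [← mul_pow]
    exact pow_le_pow_left₀ (norm_nonneg _) ((x : H →L[ℂ] H).le_opNorm _) 2
  have h1 := h (star x * x)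
  have h2 : ∀ i, ⟪g i, ((star x * x : M.toStarSubalgebra) : H →L[ℂ] H) (f i)⟫_ℂ
      = ⟪(x : H →L[ℂ] H) (g i), (x : H →L[ℂ] H) (f i)⟫_ℂ := fun i => by
    change ⟪g i, (star (x : H →L[ℂ] H) * (x : H →L[ℂ] H)) (f i)⟫_ℂ = _
    rw [mul_apply_eq_comp, ContinuousLinearMap.star_eq_adjoint,
      ContinuousLinearMap.adjoint_inner_right]
  simp only [h2] at h1
  have h3 := Complex.hasSum_re h1
  rw [show ‖φ (star x * x)‖ = (φ (star x * x)).re from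
    congrArg Complex.re (RCLike.norm_of_nonneg' (hp x))]
  refine hasSum_le (fun i => ?_) h3 hs'.hasSum
  rw [map_add, add_comm, @norm_add_sq ℂ]
  have h4 : 0 ≤ ‖(x : H →L[ℂ] H) (g i) + (x : H →L[ℂ] H) (f i)‖ ^ 2 := by positivity
  rw [@norm_add_sq ℂ] at h4
  simp only [RCLike.re_to_complex] at *
  nlinarith [sq_nonneg ‖(x : H →L[ℂ] H) (g i)‖, sq_nonneg ‖(x : H →L[ℂ] H) (f i)‖]

/-- A positive ultraweakly continuous functional is a sum of vector functionals. -/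
theorem exists_hasSum_of_mem_predualPos {φ : M.toStarSubalgebra →ₗ[ℂ] ℂ}
    (hφ : φ ∈ M.predualPos) : ∃ f : ℕ → H, Summable (fun i => ‖f i‖ ^ 2) ∧
      ∀ x : M.toStarSubalgebra, HasSum (fun i => ⟪f i, (x : H →L[ℂ] H) (f i)⟫_ℂ) (φ x) := by
  obtain ⟨h, hh, hdom⟩ := exists_dominating_of_mem_predualPos hφ
  -- In the diagonal amplification `D` of `M` to `ℓ²(H)`, the whole sequence `h` is one vector, so
  -- the dominating sum is `‖D x h‖²`.
  let K := lp (fun _ : ℕ => H) 2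
  let D : M.toStarSubalgebra → K →L[ℂ] K := fun x =>
    lp.mapCLM 2 (fun _ => (x : H →L[ℂ] H)) (norm_nonneg (x : H →L[ℂ] H)) (fun _ => le_rfl)
  have hD : ∀ x (v : K) i, D x v i = (x : H →L[ℂ] H) (v i) := fun x v i => rfl
  have hDmul : ∀ x y v, D (x * y) v = D x (D y v) := fun x y v => by
    ext i; simp only [hD]; rfl
  have hDstar : ∀ x v w, ⟪D (star x) v, w⟫_ℂ = ⟪v, D x w⟫_ℂ := fun x v w => by
    rw [lp.inner_eq_tsum, lp.inner_eq_tsum]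
    refine tsum_congr fun i => ?_
    rw [hD, hD]
    change ⟪(star (x : H →L[ℂ] H)) (v i), _⟫_ℂ = _
    rw [ContinuousLinearMap.star_eq_adjoint, ContinuousLinearMap.adjoint_inner_left]
  let h' : K := ⟨h, memℓp_gen (by simpa using hh)⟩
  let j₀ : M.toStarSubalgebra →ₗ[ℂ] K :=
    { toFun := fun x => D x h'
      map_add' := fun x y => by ext i; simp only [hD]; rfl
      map_smul' := fun c x => by ext i; simp only [hD]; rfl }
  -- Restricting to the closure of `D(M) h` makes `h` cyclic; the components of the vector `w` found
  -- there are the required `f i`.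
  let V : Submodule ℂ K := (LinearMap.range j₀).topologicalClosure
  have hVc : IsClosed (V : Set K) := Submodule.isClosed_topologicalClosure _
  have : CompleteSpace V := hVc.completeSpace_coe
  let j : M.toStarSubalgebra →ₗ[ℂ] V := j₀.codRestrict V fun x =>
    Submodule.le_topologicalClosure _ ⟨x, rfl⟩
  have hj : DenseRange j := by
    refine (Topology.IsInducing.subtypeVal.dense_iff).2 fun v => ?_
    have hv : (v : K) ∈ closure (LinearMap.range j₀ : Set K) := v.2
    refine closure_mono ?_ hv
    rintro _ ⟨x, rfl⟩
    exact ⟨j x, ⟨x, rfl⟩, rfl⟩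
  have hDV : ∀ x, ∀ v ∈ V, D x v ∈ V := fun x v hv => by
    refine map_mem_closure (D x).continuous hv ?_
    rintro _ ⟨y, rfl⟩
    exact ⟨x * y, hDmul x y h'⟩
  let P : M.toStarSubalgebra → V →L[ℂ] V := fun x =>
    ((D x).comp V.subtypeL).codRestrict V fun v => hDV x v v.2
  have hPj : ∀ x y, P x (j y) = j (x * y) := fun x y => Subtype.ext (hDmul x y h').symm
  have hPstar : ∀ x v w, ⟪P (star x) v, w⟫_ℂ = ⟪v, P x w⟫_ℂ := fun x v w => hDstar x v w
  have hjn : ∀ x, ‖j x‖ ^ 2 = ∑' i, ‖(x : H →L[ℂ] H) (h i)‖ ^ 2 := fun x => by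
    have : ‖j₀ x‖ ^ (2 : ℝ≥0∞).toReal = _ := lp.norm_rpow_eq_tsum (p := 2) (by norm_num) (j₀ x)
    rw [ENNReal.toReal_ofNat] at this
    exact_mod_cast this
  obtain ⟨w, hw⟩ := exists_vector_of_dominated φ hφ.2 P j hj hPj hPstar fun x =>
    (hdom x).trans (hjn x).ge
  refine ⟨fun i => (w : K) i, ?_, fun x => ?_⟩
  · have := (memℓp_gen_iff (p := 2) (by norm_num)).1 (lp.memℓp (w : K))
    simpa using this
  · rw [hw]
    exact lp.hasSum_inner (w : K) (D x w)

end VonNeumannAlgebra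

/-! ### Square roots of commuting positive operators -/

section SquareRoots

variable {H : Type*} [NormedAddCommGroup H] [InnerProductSpace ℂ H]

theorem ContinuousLinearMap.re_inner_nonneg_of_nonneg {T : H →L[ℂ] H} (hT : 0 ≤ T) (u : H) :
    0 ≤ (⟪T u, u⟫_ℂ).re :=
  ((ContinuousLinearMap.nonneg_iff_isPositive T).1 hT).re_inner_nonneg_left u

variable [CompleteSpace H]

theorem ContinuousLinearMap.re_inner_mono {S T : H →L[ℂ] H} (h : S ≤ T) (u : H) :
    (⟪S u, u⟫_ℂ).re ≤ (⟪T u, u⟫_ℂ).re := by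
  have h1 := re_inner_nonneg_of_nonneg (sub_nonneg.2 h) u
  rw [sub_apply, inner_sub_left, Complex.sub_re] at h1
  linarith

theorem IsSelfAdjoint.norm_sq_apply {T : H →L[ℂ] H} (hT : IsSelfAdjoint T) (u : H) :
    ‖T u‖ ^ 2 = (⟪(T * T) u, u⟫_ℂ).re := by
  have h : ⟪(T * T) u, u⟫_ℂ = ⟪T u, T u⟫_ℂ := hT.isSymmetric (T u) u
  rw [h, inner_self_eq_norm_sq_to_K]
  norm_cast

theorem norm_sq_sqrt_apply {T : H →L[ℂ] H} (hT : 0 ≤ T) (u : H) :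
    ‖CFC.sqrt T u‖ ^ 2 = (⟪T u, u⟫_ℂ).re := by
  rw [(IsSelfAdjoint.of_nonneg (CFC.sqrt_nonneg T)).norm_sq_apply, CFC.sqrt_mul_sqrt_self T hT]

/-- For commuting `0 ≤ S ≤ T`, the operator `(T^{1/2} - S^{1/2})²` is at most `T - S`. -/
theorem norm_sq_sqrt_sub_sqrt_le {S T : H →L[ℂ] H} (hS : 0 ≤ S) (hST : S ≤ T)
    (hc : Commute S T) (u : H) :
    ‖CFC.sqrt T u - CFC.sqrt S u‖ ^ 2 ≤ ‖CFC.sqrt T u‖ ^ 2 - ‖CFC.sqrt S u‖ ^ 2 := by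
  have hT := hS.trans hST
  set s := CFC.sqrt S with hs
  set d := CFC.sqrt T - CFC.sqrt S with hd
  have hs0 : 0 ≤ s := CFC.sqrt_nonneg S
  have hd0 : 0 ≤ d := sub_nonneg.2 (CFC.sqrt_le_sqrt S T hST)
  have hcomm : Commute s (CFC.sqrt T) :=
    ((hc.cfcₙ_nnreal NNReal.sqrt).symm.cfcₙ_nnreal NNReal.sqrt).symm
  have hsd : Commute s d := hcomm.sub_right (Commute.refl _)
  have h1 := ContinuousLinearMap.re_inner_nonneg_of_nonneg (Commute.mul_nonneg hs0 hd0 hsd) u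
  -- This is `(s + d)² - s²`. The term `s d` is positive, as `d ≥ 0` by operator monotonicity of the
  -- square root and `d` commutes with `s`.
  have h2 : T - S = d * d + 2 • (s * d) := by
    have e1 : CFC.sqrt T * CFC.sqrt T = T := CFC.sqrt_mul_sqrt_self T hT
    have e2 : s * s = S := CFC.sqrt_mul_sqrt_self S hS
    rw [← e1, ← e2, show d = CFC.sqrt T - s from rfl]
    simp only [sub_mul, mul_sub, ← hcomm.eq]
    abel
  have h3 : (⟪(T - S) u, u⟫_ℂ).re = ‖d u‖ ^ 2 + 2 * (⟪(s * d) u, u⟫_ℂ).re := by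
    rw [h2, (IsSelfAdjoint.of_nonneg hd0).norm_sq_apply, two_smul, add_apply, add_apply,
      inner_add_left, inner_add_left, Complex.add_re, Complex.add_re]
    ring
  rw [sub_apply, inner_sub_left, Complex.sub_re, ← norm_sq_sqrt_apply hT,
    ← norm_sq_sqrt_apply hS] at h3
  have h4 : CFC.sqrt T u - s u = d u := rfl
  rw [h4]
  linarith

end SquareRoots

/-! ### Convergence of `a_t^{1/2}` to `a^{1/2}` and the form domain -/

namespace PosAffiliated

variable {H : Type*} [NormedAddCommGroup H] [InnerProductSpace ℂ H] [CompleteSpace H]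
  {M : VonNeumannAlgebra H} (a : PosAffiliated M)

theorem yosida_mono {s t : ℝ} (hs : 0 < s) (hst : s ≤ t) : a.yosida s ≤ a.yosida t := by
  have ht := hs.trans_le hst
  rw [← sub_nonneg, a.yosida_sub s t hs ht]
  have h : (0 : ℝ) ≤ (t - s) / (t * s) := div_nonneg (sub_nonneg.2 hst) (by positivity)
  have h' : ((t - s) / (t * s) : ℂ) = (((t - s) / (t * s) : ℝ) : ℂ) := by push_cast; rfl
  rw [h']
  exact smul_nonneg (by exact_mod_cast h) (Commute.mul_nonneg (a.yosida_nonneg t)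
    (a.yosida_nonneg s) (a.yosida_commute t s))

theorem norm_sqrtYosida_mono {s t : ℝ} (hs : 0 < s) (hst : s ≤ t) (u : H) :
    ‖CFC.sqrt (a.yosida s) u‖ ^ 2 ≤ ‖CFC.sqrt (a.yosida t) u‖ ^ 2 := by
  rw [norm_sq_sqrt_apply (a.yosida_nonneg s), norm_sq_sqrt_apply (a.yosida_nonneg t)]
  exact ContinuousLinearMap.re_inner_mono (a.yosida_mono hs hst) u

/-- Turns the Cauchy property of the numbers `‖a_t^{1/2} u‖²` into that of the vectors `a_t^{1/2}
u`. -/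
theorem norm_sq_sqrtYosida_sub_le {s t : ℝ} (hs : 0 < s) (ht : 0 < t) (u : H) :
    ‖CFC.sqrt (a.yosida t) u - CFC.sqrt (a.yosida s) u‖ ^ 2 ≤
      |‖CFC.sqrt (a.yosida t) u‖ ^ 2 - ‖CFC.sqrt (a.yosida s) u‖ ^ 2| := by
  rcases le_total s t with h | h
  · exact (norm_sq_sqrt_sub_sqrt_le (a.yosida_nonneg s) (a.yosida_mono hs h)
      (a.yosida_commute s t) u).trans (le_abs_self _)
  · rw [norm_sub_rev, abs_sub_comm]
    exact (norm_sq_sqrt_sub_sqrt_le (a.yosida_nonneg t) (a.yosida_mono ht h)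
      (a.yosida_commute t s) u).trans (le_abs_self _)

theorem norm_yosida_apply_le {t : ℝ} (ht : 0 < t) (y : H) : ‖a.yosida t y‖ ≤ 2 * t * ‖y‖ := by
  obtain ⟨x, rfl⟩ := a.shift_surjective t ht y
  rw [shift_apply, a.yosida_apply t ht, norm_smul, Complex.norm_real, Real.norm_of_nonneg ht.le]
  nlinarith [a.norm_op_le t ht x]

/-- From `t a_t x = t a x - a_t (a x)` and `‖a_t‖ ≤ 2 t`. The point is a bound uniform in `t` on the
domain of `a`. -/
theorem norm_yosida_apply_domain_le {t : ℝ} (ht : 0 < t) (x : a.op.domain) :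
    ‖a.yosida t x‖ ≤ 3 * ‖a.op x‖ := by
  have h1 := a.yosida_apply t ht x
  rw [map_add, map_smul] at h1
  have h2 : (t : ℂ) • a.yosida t x = (t : ℂ) • a.op x - a.yosida t (a.op x) :=
    eq_sub_of_add_eq h1
  have h3 := congrArg norm h2
  rw [norm_smul, Complex.norm_real, Real.norm_of_nonneg ht.le] at h3
  have h4 := norm_sub_le ((t : ℂ) • a.op x) (a.yosida t (a.op x))
  rw [norm_smul, Complex.norm_real, Real.norm_of_nonneg ht.le] at h4
  have h5 := a.norm_yosida_apply_le ht (a.op x)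
  have h6 : t * ‖a.yosida t x‖ ≤ t * (3 * ‖a.op x‖) := by rw [h3]; linarith
  exact le_of_mul_le_mul_left h6 ht

/-- `t⁻¹ a_t = a (t + a)⁻¹` tends to `0` strongly. -/
theorem tendsto_inv_mul_norm_yosida (y : H) :
    Tendsto (fun t : ℝ => t⁻¹ * ‖a.yosida t y‖) atTop (𝓝 0) := by
  rw [Metric.tendsto_nhds]
  intro ε hε
  -- Approximating `y` by `x ∈ D(a)` costs at most `2 ‖y - x‖ < ε / 2` for every `t`; on `x` itself
  -- `a_t` is bounded in `t`, so the factor `t⁻¹` makes the rest small.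
  obtain ⟨x, hx, hxy⟩ := Metric.mem_closure_iff.1 (a.isSelfAdjoint.dense_domain y) (ε / 4)
    (by positivity)
  have h1 : Tendsto (fun t : ℝ => t⁻¹ * (3 * ‖a.op ⟨x, hx⟩‖)) atTop (𝓝 0) := by
    simpa using tendsto_inv_atTop_zero.mul_const (3 * ‖a.op ⟨x, hx⟩‖)
  filter_upwards [eventually_gt_atTop 0, h1.eventually (gt_mem_nhds (half_pos hε))] with t ht h2
  rw [dist_zero_right, Real.norm_of_nonneg (by positivity)]
  have h3 : ‖a.yosida t y‖ ≤ ‖a.yosida t (y - x)‖ + ‖a.yosida t x‖ := by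
    have := norm_add_le (a.yosida t (y - x)) (a.yosida t x)
    rwa [← map_add, sub_add_cancel] at this
  have h4 := a.norm_yosida_apply_le ht (y - x)
  have h5 := a.norm_yosida_apply_domain_le ht ⟨x, hx⟩
  rw [dist_eq_norm] at hxy
  calc t⁻¹ * ‖a.yosida t y‖ ≤ t⁻¹ * (2 * t * ‖y - x‖ + 3 * ‖a.op ⟨x, hx⟩‖) :=
        mul_le_mul_of_nonneg_left (by linarith) (by positivity)
    _ = 2 * ‖y - x‖ + t⁻¹ * (3 * ‖a.op ⟨x, hx⟩‖) := by field_simp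
    _ < ε := by linarith

/-- The resolvent identity between `1` and `t`. It shows that `a_t (1 - b)`, with `b = a_1`, falls
short of `b` only by `t⁻¹ a_t b`. -/
theorem yosida_mul_one_sub {t : ℝ} (ht : 0 < t) : a.yosida t * (1 - a.yosida 1) =
    a.yosida 1 - ((t⁻¹ : ℝ) : ℂ) • (a.yosida t * a.yosida 1) := by
  have h := a.yosida_sub 1 t one_pos ht
  have ht' : (t : ℂ) ≠ 0 := by exact_mod_cast ht.ne'
  have h2 : ((t - (1 : ℝ)) / (t * (1 : ℝ)) : ℂ) = 1 - ((t⁻¹ : ℝ) : ℂ) := by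
    push_cast; field_simp
  rw [h2, sub_smul, one_smul, sub_eq_iff_eq_add] at h
  rw [mul_sub, mul_one]
  nth_rw 1 [h]
  abel

/-- `a_t^{1/2} f → a^{1/2} f` for `f` in the domain of `a^{1/2}`. -/
theorem tendsto_sqrtYosida_apply (f : a.sqrt.domain) :
    Tendsto (fun t : ℝ => CFC.sqrt (a.yosida t) f) atTop (𝓝 (a.sqrt f)) := by
  obtain ⟨f, hf⟩ := f
  obtain ⟨u, rfl⟩ := (a.mem_sqrt_domain f).1 hf
  rw [a.sqrt_apply]
  have hc0 : 0 ≤ 1 - a.yosida 1 := sub_nonneg.2 a.yosida_one_le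
  -- With `b = a_1` and `f = (1 - b)^{1/2} u`, the vectors compared are `b^{1/2} u` and `(a_t (1 -
  -- b))^{1/2} u`. The square-root estimate bounds the squared distance by `⟨t⁻¹ a_t b u, u⟩`.
  have key : ∀ t : ℝ, 0 < t → ‖CFC.sqrt (a.yosida 1) u -
      CFC.sqrt (a.yosida t) (CFC.sqrt (1 - a.yosida 1) u)‖ ^ 2 ≤
        t⁻¹ * ‖a.yosida t (a.yosida 1 u)‖ * ‖u‖ := by
    intro t ht
    have hcomm : Commute (a.yosida t) (1 - a.yosida 1) :=
      (Commute.one_right _).sub_right (a.yosida_commute t 1)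
    have hcomm' : Commute (CFC.sqrt (a.yosida t)) (CFC.sqrt (1 - a.yosida 1)) :=
      ((hcomm.cfcₙ_nnreal NNReal.sqrt).symm.cfcₙ_nnreal NNReal.sqrt).symm
    have hp0 : 0 ≤ a.yosida t * (1 - a.yosida 1) :=
      Commute.mul_nonneg (a.yosida_nonneg t) hc0 hcomm
    have hsq : CFC.sqrt (a.yosida t * (1 - a.yosida 1)) =
        CFC.sqrt (a.yosida t) * CFC.sqrt (1 - a.yosida 1) := by
      refine CFC.sqrt_unique ?_ (Commute.mul_nonneg (CFC.sqrt_nonneg _) (CFC.sqrt_nonneg _) hcomm')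
      rw [mul_assoc, ← mul_assoc (CFC.sqrt (1 - a.yosida 1)), ← hcomm'.eq, mul_assoc,
        CFC.sqrt_mul_sqrt_self _ hc0, ← mul_assoc, sqrtYosida_mul_self]
    have hle : a.yosida t * (1 - a.yosida 1) ≤ a.yosida 1 := by
      rw [a.yosida_mul_one_sub ht]
      refine sub_le_self _ (smul_nonneg ?_ (Commute.mul_nonneg (a.yosida_nonneg t)
        (a.yosida_nonneg 1) (a.yosida_commute t 1)))
      exact_mod_cast (inv_pos.2 ht).le
    have h1 := norm_sq_sqrt_sub_sqrt_le hp0 hle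
      (((a.yosida_commute t 1)).mul_left ((Commute.one_left _).sub_left (Commute.refl _))) u
    rw [norm_sq_sqrt_apply (a.yosida_nonneg 1), norm_sq_sqrt_apply hp0, hsq,
      a.yosida_mul_one_sub ht, sub_apply, inner_sub_left, Complex.sub_re, sub_sub_cancel,
      smul_apply, inner_smul_left, Complex.conj_ofReal, Complex.re_ofReal_mul] at h1
    refine h1.trans ?_
    rw [mul_assoc]
    refine mul_le_mul_of_nonneg_left ?_ (inv_pos.2 ht).le
    exact (Complex.re_le_norm _).trans (norm_inner_le_norm _ _)
  have h0 : Tendsto (fun t : ℝ => ‖CFC.sqrt (a.yosida 1) u -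
      CFC.sqrt (a.yosida t) (CFC.sqrt (1 - a.yosida 1) u)‖ ^ 2) atTop (𝓝 0) := by
    have h1 := (a.tendsto_inv_mul_norm_yosida (a.yosida 1 u)).mul_const ‖u‖
    rw [zero_mul] at h1
    refine tendsto_of_tendsto_of_tendsto_of_le_of_le' tendsto_const_nhds h1
      (Eventually.of_forall fun t => by positivity) ?_
    filter_upwards [eventually_gt_atTop 0] with t ht using key t ht
  rw [tendsto_iff_norm_sub_tendsto_zero]
  have h1 := h0.sqrt
  simp only [Real.sqrt_zero, Real.sqrt_sq (norm_nonneg _)] at h1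
  exact h1.congr fun t => norm_sub_rev _ _

theorem norm_sqrtYosida_apply_le {t : ℝ} (ht : 0 < t) (f : a.sqrt.domain) :
    ‖CFC.sqrt (a.yosida t) f‖ ^ 2 ≤ ‖a.sqrt f‖ ^ 2 := by
  refine ge_of_tendsto ((a.tendsto_sqrtYosida_apply f).norm.pow 2) ?_
  filter_upwards [eventually_ge_atTop t] with s hs using a.norm_sqrtYosida_mono ht hs f

/-- If `⟨a_t f, f⟩` stays bounded then `f` belongs to the domain of `a^{1/2}`. -/
theorem mem_sqrt_domain_of_bounded {f : H} {C : ℝ}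
    (hC : ∀ t : ℝ, 0 < t → ‖CFC.sqrt (a.yosida t) f‖ ^ 2 ≤ C) : f ∈ a.sqrt.domain := by
  -- A bounded increasing sequence, hence Cauchy; the shift to `n + 1` keeps the parameter positive.
  let F : ℕ → ℝ := fun n => ‖CFC.sqrt (a.yosida (n + 1)) f‖ ^ 2
  have hF : Monotone F := fun m n hmn =>
    a.norm_sqrtYosida_mono (by positivity) (by gcongr) f
  have hFb : BddAbove (Set.range F) := ⟨C, by rintro _ ⟨n, rfl⟩; exact hC _ (by positivity)⟩
  have hFc : CauchySeq F := (tendsto_atTop_ciSup hF hFb).cauchySeq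
  have hu : CauchySeq fun n : ℕ => CFC.sqrt (a.yosida (n + 1)) f := by
    rw [Metric.cauchySeq_iff] at hFc ⊢
    intro ε hε
    obtain ⟨N, hN⟩ := hFc (ε ^ 2) (by positivity)
    refine ⟨N, fun m hm n hn => ?_⟩
    have h1 := a.norm_sq_sqrtYosida_sub_le (s := (n : ℝ) + 1) (t := (m : ℝ) + 1) (by positivity)
      (by positivity) f
    have h2 := hN m hm n hn
    rw [Real.dist_eq] at h2
    rw [dist_eq_norm]
    exact lt_of_pow_lt_pow_left₀ 2 hε.le (h1.trans_lt h2)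
  obtain ⟨w, hw⟩ := cauchySeq_tendsto_of_complete hu
  have ht : Tendsto (fun n : ℕ => (n : ℝ) + 1) atTop atTop :=
    tendsto_natCast_atTop_atTop.atTop_add tendsto_const_nhds
  -- This places `f` in the domain of the adjoint of `a^{1/2}`, which is `a^{1/2}` itself.
  have hinner : ∀ g : a.sqrt.domain, ⟪w, (g : H)⟫_ℂ = ⟪f, a.sqrt g⟫_ℂ := by
    intro g
    have h1 : Tendsto (fun n : ℕ => ⟪CFC.sqrt (a.yosida (n + 1)) f, (g : H)⟫_ℂ) atTop
      (𝓝 ⟪w, (g : H)⟫_ℂ) := hw.inner tendsto_const_nhds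
    have h2 : Tendsto (fun n : ℕ => ⟪f, CFC.sqrt (a.yosida (n + 1)) (g : H)⟫_ℂ) atTop
      (𝓝 ⟪f, a.sqrt g⟫_ℂ) := tendsto_const_nhds.inner ((a.tendsto_sqrtYosida_apply g).comp ht)
    refine tendsto_nhds_unique h1 (h2.congr fun n => ?_)
    rw [inner_sqrt_left]
  have hadj : a.sqrt.adjoint = a.sqrt := a.sqrt_isSelfAdjoint
  rw [← hadj]
  exact LinearPMap.mem_adjoint_domain_of_exists _ ⟨w, hinner⟩

/-- The orthogonal complement of the range of the self-adjoint `a^{1/2}` is its kernel, and `a^{1/2}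
f = 0` forces `a f = 0`. -/
theorem denseRange_sqrt (ha : Function.Injective a.op) : DenseRange a.sqrt.toFun := by
  have hinj : ∀ f : a.sqrt.domain, a.sqrt f = 0 → (f : H) = 0 := by
    intro f hf
    have h' : a.sqrt ⟨f, f.2⟩ ∈ a.sqrt.domain := by
      change a.sqrt f ∈ _
      rw [hf]; exact zero_mem _
    have h0 : a.sqrt ⟨_, h'⟩ = 0 := by
      rw [show (⟨_, h'⟩ : a.sqrt.domain) = 0 from Subtype.ext hf, LinearPMap.map_zero]
    obtain ⟨h, hh⟩ := (a.sqrt_sq f 0).2 ⟨f.2, h', h0⟩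
    have : (⟨f, h⟩ : a.op.domain) = 0 := ha (by rw [hh, LinearPMap.map_zero])
    exact congrArg Subtype.val this
  have : Dense (LinearMap.range a.sqrt.toFun : Set H) := by
    rw [Submodule.dense_iff_topologicalClosure_eq_top, Submodule.topologicalClosure_eq_top_iff,
      Submodule.eq_bot_iff]
    intro y hy
    have h0 : ∀ g : a.sqrt.domain, ⟪(0 : H), (g : H)⟫_ℂ = ⟪y, a.sqrt g⟫_ℂ := fun g => by
      rw [inner_zero_left]
      exact ((Submodule.mem_orthogonal' _ _).1 hy _ ⟨g, rfl⟩).symm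
    have hdom : y ∈ a.sqrt.adjoint.domain := LinearPMap.mem_adjoint_domain_of_exists _ ⟨0, h0⟩
    have hval : a.sqrt.adjoint ⟨y, hdom⟩ = 0 := LinearPMap.adjoint_apply_eq a.sqrt_dense _ h0
    have hadj : a.sqrt.adjoint = a.sqrt := a.sqrt_isSelfAdjoint
    have key : ∃ h : y ∈ a.sqrt.domain, a.sqrt ⟨y, h⟩ = 0 := by
      rw [← hadj]; exact ⟨hdom, hval⟩
    obtain ⟨h, hy0⟩ := key
    exact hinj ⟨y, h⟩ hy0
  exact this

/-- `a^{1/2}` commutes with the commutant of `M`. -/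
theorem sqrt_commutant {u : H →L[ℂ] H} (hu : u ∈ M.commutant) (f : a.sqrt.domain) :
    ∃ h : u f ∈ a.sqrt.domain, a.sqrt ⟨u f, h⟩ = u (a.sqrt f) := by
  obtain ⟨f, hf⟩ := f
  obtain ⟨v, rfl⟩ := (a.mem_sqrt_domain f).1 hf
  have hcomm : ∀ T ∈ M, ∀ x, u (T x) = T (u x) := fun T hT x =>
    (DFunLike.congr_fun (VonNeumannAlgebra.mem_commutant_iff.1 hu T hT) x).symm
  have h1 : u (CFC.sqrt (1 - a.yosida 1) v) = CFC.sqrt (1 - a.yosida 1) (u v) :=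
    hcomm _ (sqrt_mem (sub_mem (one_mem M) (a.yosida_mem 1))) v
  have h2 := (a.mem_sqrt_domain _).2 ⟨u v, h1.symm⟩
  refine ⟨h2, ?_⟩
  rw [a.sqrt_apply, hcomm _ (sqrt_mem (a.yosida_mem 1)), ← a.sqrt_apply _ (h1 ▸ h2)]
  congr 1
  exact Subtype.ext h1

end PosAffiliated

/-! ### Functionals in `𝔇_a^+` as vector sums over `D(a^{1/2})` -/

namespace VonNeumannAlgebra

variable {H : Type*} [NormedAddCommGroup H] [InnerProductSpace ℂ H] [CompleteSpace H]
  (M : VonNeumannAlgebra H)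

/-- The functional `x ↦ ⟨x g, f⟩` on `M`. -/
noncomputable def vectorFunctional (f g : H) : M.toStarSubalgebra →ₗ[ℂ] ℂ where
  toFun x := ⟪f, (x : H →L[ℂ] H) g⟫_ℂ
  map_add' _ _ := inner_add_right _ _ _
  map_smul' _ _ := inner_smul_right _ _ _

theorem vectorFunctional_apply (f g : H) (x : M.toStarSubalgebra) :
    M.vectorFunctional f g x = ⟪f, (x : H →L[ℂ] H) g⟫_ℂ := rfl

variable {M}

theorem mem_predualPos_of_hasSum {φ : M.toStarSubalgebra →ₗ[ℂ] ℂ} {f : ℕ → H}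
    (hf : Summable fun i => ‖f i‖ ^ 2)
    (h : ∀ x : M.toStarSubalgebra, HasSum (fun i => ⟪f i, (x : H →L[ℂ] H) (f i)⟫_ℂ) (φ x)) :
    φ ∈ M.predualPos := by
  refine ⟨⟨f, f, hf, hf, h⟩, fun x => (h (star x * x)).nonneg fun i => ?_⟩
  change 0 ≤ ⟪f i, (star (x : H →L[ℂ] H) * (x : H →L[ℂ] H)) (f i)⟫_ℂ
  rw [mul_apply_eq_comp, ContinuousLinearMap.star_eq_adjoint,
    ContinuousLinearMap.adjoint_inner_right, inner_self_eq_norm_sq_to_K]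
  norm_cast
  positivity

end VonNeumannAlgebra

namespace PosAffiliated

variable {H : Type*} [NormedAddCommGroup H] [InnerProductSpace ℂ H] [CompleteSpace H]
  {M : VonNeumannAlgebra H} (a : PosAffiliated M)

/-- `φ` is the sum of the vector functionals of the vectors `f i` in the domain of `a^{1/2}`, and
`∑ ‖a^{1/2} f i‖² < ∞`. -/
structure IsVectorSum (φ : M.toStarSubalgebra →ₗ[ℂ] ℂ) (f : ℕ → a.sqrt.domain) : Prop where
  summable : Summable fun i => ‖(f i : H)‖ ^ 2
  summable_sqrt : Summable fun i => ‖a.sqrt (f i)‖ ^ 2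
  hasSum : ∀ x : M.toStarSubalgebra,
    HasSum (fun i => ⟪(f i : H), (x : H →L[ℂ] H) (f i)⟫_ℂ) (φ x)

theorem inner_yosida_self (t : ℝ) (f : H) :
    ⟪f, a.yosida t f⟫_ℂ = ((‖CFC.sqrt (a.yosida t) f‖ ^ 2 : ℝ) : ℂ) := by
  conv_lhs => rw [← a.sqrtYosida_mul_self, mul_apply_eq_comp, ← inner_sqrt_left,
    inner_self_eq_norm_sq_to_K]
  norm_cast

/-- Any representation of `φ` by vectors will do: `∑ ‖a_t^{1/2} f i‖² = φ(a_t) ≤ φ(a)` puts each `f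
i` in the form domain, and `t → ∞` in the finite partial sums gives summability. -/
theorem exists_isVectorSum {φ : M.toStarSubalgebra →ₗ[ℂ] ℂ} (hφ : φ ∈ a.domPos) :
    ∃ f, a.IsVectorSum φ f := by
  obtain ⟨f, hf, h⟩ := VonNeumannAlgebra.exists_hasSum_of_mem_predualPos hφ.1
  have hsum : ∀ t : ℝ, HasSum (fun i => ‖CFC.sqrt (a.yosida t) (f i)‖ ^ 2)
      (φ (a.yosidaM t)).re := fun t => by
    refine (Complex.hasSum_re (h (a.yosidaM t))).congr_fun fun i => ?_
    change _ = (⟪f i, a.yosida t (f i)⟫_ℂ).re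
    rw [inner_yosida_self, Complex.ofReal_re]
  have hle : ∀ t : ℝ, 0 < t → (φ (a.yosidaM t)).re ≤ (a.eval φ).toReal := fun t ht => by
    have h1 : ENNReal.ofReal (φ (a.yosidaM t)).re ≤ a.eval φ := by
      refine ge_of_tendsto (a.tendsto_eval hφ.1) ?_
      filter_upwards [eventually_ge_atTop t] with s hs
      exact ENNReal.ofReal_le_ofReal (a.monotone_eval hφ.1 ht hs)
    exact (ENNReal.ofReal_le_iff_le_toReal hφ.2.ne).1 h1
  have hfin : ∀ (s : Finset ℕ) (t : ℝ), 0 < t →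
      ∑ i ∈ s, ‖CFC.sqrt (a.yosida t) (f i)‖ ^ 2 ≤ (a.eval φ).toReal := fun s t ht =>
    (sum_le_hasSum s (fun i _ => by positivity) (hsum t)).trans (hle t ht)
  have hdom : ∀ i, f i ∈ a.sqrt.domain := fun i =>
    a.mem_sqrt_domain_of_bounded (C := (a.eval φ).toReal) fun t ht => by
      simpa using hfin {i} t ht
  refine ⟨fun i => ⟨f i, hdom i⟩, hf, ?_, h⟩
  refine summable_of_sum_le (c := (a.eval φ).toReal) (fun i => by positivity) fun s => ?_
  refine le_of_tendsto (tendsto_finsetSum s fun i _ =>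
    (a.tendsto_sqrtYosida_apply ⟨f i, hdom i⟩).norm.pow 2) ?_
  filter_upwards [eventually_gt_atTop 0] with t ht using hfin s t ht

variable {a}

namespace IsVectorSum

variable {φ : M.toStarSubalgebra →ₗ[ℂ] ℂ} {f : ℕ → a.sqrt.domain}

theorem mem_predualPos (h : a.IsVectorSum φ f) : φ ∈ M.predualPos :=
  VonNeumannAlgebra.mem_predualPos_of_hasSum h.summable h.hasSum

/-- Dominated convergence with majorant `‖x‖ ‖a^{1/2} f i‖²`. -/
theorem tendsto_apply (h : a.IsVectorSum φ f) (x : M.toStarSubalgebra) :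
    Tendsto (fun t : ℝ => φ (a.sqrtYosidaM t * x * a.sqrtYosidaM t)) atTop
      (𝓝 (∑' i, ⟪a.sqrt (f i), (x : H →L[ℂ] H) (a.sqrt (f i))⟫_ℂ)) := by
  have h1 : ∀ t : ℝ, φ (a.sqrtYosidaM t * x * a.sqrtYosidaM t) =
      ∑' i, ⟪CFC.sqrt (a.yosida t) (f i : H),
        (x : H →L[ℂ] H) (CFC.sqrt (a.yosida t) (f i : H))⟫_ℂ := fun t => by
    rw [← (h.hasSum _).tsum_eq]
    refine tsum_congr fun i => ?_
    rw [inner_sqrt_left]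
    rfl
  simp only [h1]
  refine tendsto_tsum_of_dominated_convergence
    (h.summable_sqrt.mul_left ‖(x : H →L[ℂ] H)‖) (fun i => ?_) ?_
  · have h2 := a.tendsto_sqrtYosida_apply (f i)
    exact h2.inner (((x : H →L[ℂ] H).continuous.tendsto _).comp h2)
  · filter_upwards [eventually_gt_atTop 0] with t ht i
    have h2 := norm_inner_le_norm (𝕜 := ℂ) (CFC.sqrt (a.yosida t) (f i : H))
      ((x : H →L[ℂ] H) (CFC.sqrt (a.yosida t) (f i : H)))
    have h3 := (x : H →L[ℂ] H).le_opNorm (CFC.sqrt (a.yosida t) (f i : H))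
    have h4 := mul_le_mul_of_nonneg_left (a.norm_sqrtYosida_apply_le ht (f i))
      (norm_nonneg (x : H →L[ℂ] H))
    nlinarith [norm_nonneg (CFC.sqrt (a.yosida t) (f i : H))]

theorem eval_eq (h : a.IsVectorSum φ f) : a.eval φ = ENNReal.ofReal (∑' i, ‖a.sqrt (f i)‖ ^ 2) := by
  refine tendsto_nhds_unique (a.tendsto_eval h.mem_predualPos) ?_
  have h1 := h.tendsto_apply 1
  have h2 : (∑' i, ⟪a.sqrt (f i), ((1 : M.toStarSubalgebra) : H →L[ℂ] H) (a.sqrt (f i))⟫_ℂ) =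
      ((∑' i, ‖a.sqrt (f i)‖ ^ 2 : ℝ) : ℂ) := by
    rw [Complex.ofReal_tsum]
    refine tsum_congr fun i => ?_
    change ⟪a.sqrt (f i), a.sqrt (f i)⟫_ℂ = _
    rw [inner_self_eq_norm_sq_to_K]
    norm_cast
  rw [h2] at h1
  have h3 := (Complex.continuous_re.tendsto _).comp h1
  rw [Complex.ofReal_re] at h3
  refine (ENNReal.continuous_ofReal.tendsto _).comp (h3.congr fun t => ?_)
  have h4 : a.sqrtYosidaM t * 1 * a.sqrtYosidaM t = a.yosidaM t := by
    rw [mul_one]; exact Subtype.ext (a.sqrtYosida_mul_self t)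
  rw [Function.comp_apply, h4]

theorem mem_domPos (h : a.IsVectorSum φ f) : φ ∈ a.domPos :=
  ⟨h.mem_predualPos, by rw [h.eval_eq]; exact ENNReal.ofReal_lt_top⟩

theorem toReal_eval (h : a.IsVectorSum φ f) : (a.eval φ).toReal = ∑' i, ‖a.sqrt (f i)‖ ^ 2 := by
  rw [h.eval_eq, ENNReal.toReal_ofReal (tsum_nonneg fun i => by positivity)]

/-- Removing finitely many terms leaves an element of `𝔇_a^+` whose value at `a` is a tail of a
convergent series. -/
theorem tail (h : a.IsVectorSum φ f) (n : ℕ) :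
    a.IsVectorSum (φ - ∑ i ∈ Finset.range n, M.vectorFunctional (f i) (f i))
      (fun i => f (i + n)) where
  summable := (summable_nat_add_iff (f := fun i => ‖(f i : H)‖ ^ 2) n).2 h.summable
  summable_sqrt := (summable_nat_add_iff (f := fun i => ‖a.sqrt (f i)‖ ^ 2) n).2 h.summable_sqrt
  hasSum x := by
    have := (hasSum_nat_add_iff' n).2 (h.hasSum x)
    rw [LinearMap.sub_apply, LinearMap.sum_apply]
    exact this

end IsVectorSum

variable (a)

theorem isVectorSum_vectorFunctional (f : a.sqrt.domain) :
    a.IsVectorSum (M.vectorFunctional f f) (fun i => if i = 0 then f else 0) where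
  summable := (hasSum_single 0 fun i hi => by simp [hi]).summable
  summable_sqrt := (hasSum_single 0 fun i hi => by simp [hi]).summable
  hasSum x := by
    have : HasSum (fun i : ℕ => ⟪((if i = 0 then f else 0 : a.sqrt.domain) : H),
      (x : H →L[ℂ] H) (if i = 0 then f else 0 : a.sqrt.domain)⟫_ℂ) _ :=
      hasSum_single 0 fun i hi => by simp [hi]
    simpa [VonNeumannAlgebra.vectorFunctional_apply] using this

theorem vectorFunctional_mem_domPos (f : a.sqrt.domain) : M.vectorFunctional f f ∈ a.domPos :=
  (a.isVectorSum_vectorFunctional f).mem_domPos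

theorem toReal_eval_vectorFunctional (f : a.sqrt.domain) :
    (a.eval (M.vectorFunctional f f)).toReal = ‖a.sqrt f‖ ^ 2 := by
  rw [(a.isVectorSum_vectorFunctional f).toReal_eval, tsum_eq_single 0 fun i hi => by simp [hi]]
  simp

theorem tendsto_vectorFunctional_apply (f : a.sqrt.domain) (x : M.toStarSubalgebra) :
    Tendsto (fun t : ℝ => M.vectorFunctional (f : H) f (a.sqrtYosidaM t * x * a.sqrtYosidaM t))
      atTop (𝓝 ⟪a.sqrt f, (x : H →L[ℂ] H) (a.sqrt f)⟫_ℂ) := by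
  have := (a.isVectorSum_vectorFunctional f).tendsto_apply x
  rw [tsum_eq_single 0 fun i hi => by simp [hi]] at this
  simpa using this

/-- The vector functional `x ↦ ⟨x f, f⟩` of `f ∈ D(a^{1/2})` as an element of `𝔇_a^h`. -/
noncomputable def vectorH (f : a.sqrt.domain) : a.domH :=
  ⟨M.vectorFunctional f f, a.domPos_subset (a.vectorFunctional_mem_domPos f)⟩

theorem coe_vectorH (f : a.sqrt.domain) :
    (a.vectorH f : M.toStarSubalgebra →ₗ[ℂ] ℂ) = M.vectorFunctional f f := rfl

/-- Replaces continuity: `ℓ` is only finitely additive, but its order bound applied to the tail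
controls the remainder. -/
theorem IsVectorSum.abs_sub_sum_le {φ : M.toStarSubalgebra →ₗ[ℂ] ℂ} {f : ℕ → a.sqrt.domain}
    (h : a.IsVectorSum φ f) {ℓ : Module.Dual ℝ a.domH} {r : ℝ} (hr : a.IsBetween ℓ r) (n : ℕ) :
    |ℓ ⟨φ, a.domPos_subset h.mem_domPos⟩ - ∑ i ∈ Finset.range n, ℓ (a.vectorH (f i))| ≤
      r * ∑' i, ‖a.sqrt (f (i + n))‖ ^ 2 := by
  have h2 := abs_le.2 (hr _ (h.tail n).mem_domPos)
  rw [(h.tail n).toReal_eval] at h2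
  have h3 : (⟨_, a.domPos_subset (h.tail n).mem_domPos⟩ : a.domH) =
      ⟨φ, a.domPos_subset h.mem_domPos⟩ - ∑ i ∈ Finset.range n, a.vectorH (f i) := by
    refine Subtype.ext ?_
    rw [Submodule.coe_sub, Submodule.coe_sum]
    rfl
  rwa [h3, map_sub, map_sum] at h2

/-- A functional in `L_∞^{sa}(a)` is determined by its values at vector functionals. -/
theorem eq_zero_of_vectorFunctional {ℓ : Module.Dual ℝ a.domH} (hℓ : ℓ ∈ a.LInftySA)
    (h0 : ∀ f : a.sqrt.domain, ℓ (a.vectorH f) = 0) : ℓ = 0 := by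
  obtain ⟨r, hr⟩ := hℓ
  have hpos : ∀ φ (hφ : φ ∈ a.domPos), ℓ ⟨φ, a.domPos_subset hφ⟩ = 0 := by
    intro φ hφ
    obtain ⟨f, hf⟩ := a.exists_isVectorSum hφ
    have h1 : ∀ n : ℕ, |ℓ ⟨φ, a.domPos_subset hφ⟩| ≤ r * ∑' i, ‖a.sqrt (f (i + n))‖ ^ 2 := by
      intro n
      have h2 := hf.abs_sub_sum_le a hr n
      rwa [Finset.sum_eq_zero fun i _ => h0 (f i), sub_zero] at h2
    have h4 : Tendsto (fun n : ℕ => r * ∑' i, ‖a.sqrt (f (i + n))‖ ^ 2) atTop (𝓝 0) := by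
      simpa using (tendsto_sum_nat_add fun i => ‖a.sqrt (f i)‖ ^ 2).const_mul r
    exact abs_nonpos_iff.1 (ge_of_tendsto' h4 h1)
  refine LinearMap.ext fun φ => ?_
  obtain ⟨φ₁, h₁, φ₂, h₂, h⟩ := φ.2
  have : φ = ⟨φ₁, a.domPos_subset h₁⟩ - ⟨φ₂, a.domPos_subset h₂⟩ := Subtype.ext h
  rw [this, map_sub, hpos φ₁ h₁, hpos φ₂ h₂, sub_zero, LinearMap.zero_apply]

/-! ### The limit functional of a self-adjoint element -/

theorem inner_apply_eq_re {x : H →L[ℂ] H} (hx : IsSelfAdjoint x) (v : H) :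
    ⟪v, x v⟫_ℂ = ((⟪v, x v⟫_ℂ).re : ℂ) := by
  refine (Complex.conj_eq_iff_re.1 ?_).symm
  rw [inner_conj_symm]
  exact hx.isSymmetric v v

theorem isSelfAdjoint_coe (x : selfAdjoint M.toStarSubalgebra) :
    IsSelfAdjoint ((x : M.toStarSubalgebra) : H →L[ℂ] H) :=
  congrArg Subtype.val x.2.star_eq

theorem tendsto_of_isVectorSum {φ : M.toStarSubalgebra →ₗ[ℂ] ℂ} {f : ℕ → a.sqrt.domain}
    (h : a.IsVectorSum φ f) (x : selfAdjoint M.toStarSubalgebra) :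
    Tendsto (fun t : ℝ => φ (a.sqrtYosidaM t * (x : M.toStarSubalgebra) * a.sqrtYosidaM t)) atTop
      (𝓝 ((∑' i, (⟪a.sqrt (f i),
        ((x : M.toStarSubalgebra) : H →L[ℂ] H) (a.sqrt (f i))⟫_ℂ).re : ℝ) : ℂ)) := by
  rw [Complex.ofReal_tsum]
  simp only [← inner_apply_eq_re (isSelfAdjoint_coe x)]
  exact h.tendsto_apply x

/-- The functional `φ ↦ lim_t φ(a_t^{1/2} x a_t^{1/2})` on `𝔇_a^h`. -/
theorem exists_limit_functional (x : selfAdjoint M.toStarSubalgebra) :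
    ∃ ℓ : Module.Dual ℝ a.domH, ∀ φ : a.domH,
      Tendsto (fun t : ℝ => (φ : M.toStarSubalgebra →ₗ[ℂ] ℂ)
        (a.sqrtYosidaM t * (x : M.toStarSubalgebra) * a.sqrtYosidaM t)) atTop (𝓝 (ℓ φ : ℂ)) := by
  have h : ∀ φ : a.domH, ∃ r : ℝ, Tendsto (fun t : ℝ => (φ : M.toStarSubalgebra →ₗ[ℂ] ℂ)
      (a.sqrtYosidaM t * (x : M.toStarSubalgebra) * a.sqrtYosidaM t)) atTop (𝓝 (r : ℂ)) := by
    rintro ⟨φ, φ₁, h₁, φ₂, h₂, rfl⟩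
    obtain ⟨f₁, hf₁⟩ := a.exists_isVectorSum h₁
    obtain ⟨f₂, hf₂⟩ := a.exists_isVectorSum h₂
    have := (a.tendsto_of_isVectorSum hf₁ x).sub (a.tendsto_of_isVectorSum hf₂ x)
    rw [← Complex.ofReal_sub] at this
    exact ⟨_, this⟩
  -- Uniqueness of limits makes `L` linear and independent of the chosen decompositions and vectors.
  choose L hL using h
  refine ⟨{ toFun := L, map_add' := fun φ ψ => ?_, map_smul' := fun c φ => ?_ }, hL⟩
  · refine Complex.ofReal_injective (tendsto_nhds_unique (hL _) ?_)
    rw [Complex.ofReal_add]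
    exact (hL φ).add (hL ψ)
  · refine Complex.ofReal_injective (tendsto_nhds_unique (hL _) ?_)
    rw [RingHom.id_apply, smul_eq_mul, Complex.ofReal_mul]
    exact ((hL φ).const_mul (c : ℂ)).congr fun t => (Complex.real_smul).symm

/-- The functional `φ ↦ lim_t φ(a_t^{1/2} x a_t^{1/2})` on `𝔇_a^h`. -/
noncomputable def limitFunctional (x : selfAdjoint M.toStarSubalgebra) : Module.Dual ℝ a.domH :=
  (a.exists_limit_functional x).choose

theorem tendsto_limitFunctional (x : selfAdjoint M.toStarSubalgebra) (φ : a.domH) :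
    Tendsto (fun t : ℝ => (φ : M.toStarSubalgebra →ₗ[ℂ] ℂ)
      (a.sqrtYosidaM t * (x : M.toStarSubalgebra) * a.sqrtYosidaM t)) atTop
      (𝓝 (a.limitFunctional x φ : ℂ)) :=
  (a.exists_limit_functional x).choose_spec φ

theorem limitFunctional_apply {φ : M.toStarSubalgebra →ₗ[ℂ] ℂ} (hφ : φ ∈ a.domPos)
    {f : ℕ → a.sqrt.domain} (h : a.IsVectorSum φ f) (x : selfAdjoint M.toStarSubalgebra) :
    a.limitFunctional x ⟨φ, a.domPos_subset hφ⟩ =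
      ∑' i, (⟪a.sqrt (f i), ((x : M.toStarSubalgebra) : H →L[ℂ] H) (a.sqrt (f i))⟫_ℂ).re :=
  Complex.ofReal_injective (tendsto_nhds_unique (a.tendsto_limitFunctional x _)
    (a.tendsto_of_isVectorSum h x))

theorem limitFunctional_vectorFunctional (f : a.sqrt.domain)
    (x : selfAdjoint M.toStarSubalgebra) :
    a.limitFunctional x (a.vectorH f) =
      (⟪a.sqrt f, ((x : M.toStarSubalgebra) : H →L[ℂ] H) (a.sqrt f)⟫_ℂ).re := by
  refine Complex.ofReal_injective (tendsto_nhds_unique (a.tendsto_limitFunctional x _) ?_)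
  rw [← inner_apply_eq_re (isSelfAdjoint_coe x)]
  exact a.tendsto_vectorFunctional_apply f x

/-- Order bounds need testing only on vector functionals: a general `φ` is a vector sum, and the
estimates add up to `r φ(a)`. -/
theorem isBetween_limitFunctional_iff (x : selfAdjoint M.toStarSubalgebra) (r : ℝ) :
    a.IsBetween (a.limitFunctional x) r ↔ ∀ f : a.sqrt.domain,
      |(⟪a.sqrt f, ((x : M.toStarSubalgebra) : H →L[ℂ] H) (a.sqrt f)⟫_ℂ).re|
        ≤ r * ‖a.sqrt f‖ ^ 2 := by
  constructor
  · intro h f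
    have := abs_le.2 (h _ (a.vectorFunctional_mem_domPos f))
    change |a.limitFunctional x (a.vectorH f)| ≤ _ at this
    rwa [limitFunctional_vectorFunctional, toReal_eval_vectorFunctional] at this
  · intro h φ hφ
    obtain ⟨f, hf⟩ := a.exists_isVectorSum hφ
    rw [← abs_le, a.limitFunctional_apply hφ hf, hf.toReal_eval, ← tsum_mul_left, ← Real.norm_eq_abs]
    exact tsum_of_norm_bounded (hf.summable_sqrt.mul_left r).hasSum fun i => h (f i)

theorem limitFunctional_mem (x : selfAdjoint M.toStarSubalgebra) :
    a.limitFunctional x ∈ a.LInftySA := by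
  refine ⟨‖((x : M.toStarSubalgebra) : H →L[ℂ] H)‖,
    (a.isBetween_limitFunctional_iff x _).2 fun f => ?_⟩
  refine (Complex.abs_re_le_norm _).trans ((norm_inner_le_norm _ _).trans ?_)
  nlinarith [((x : M.toStarSubalgebra) : H →L[ℂ] H).le_opNorm (a.sqrt f), norm_nonneg (a.sqrt f)]

end PosAffiliated

/-! ### Recovering an operator from a functional -/

section SesquilinearOfReal

variable {E : Type*} [AddCommGroup E] [Module ℂ E] [Module ℝ E] [IsScalarTower ℝ ℂ E]

/-- The sesquilinear form with real part `β`. -/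
noncomputable def sesquilinearOfReal (β : E →ₗ[ℝ] E →ₗ[ℝ] ℝ)
    (hβ : ∀ (c : ℂ) (f g : E), β (c • f) g = β f (starRingEnd ℂ c • g)) :
    E →ₗ⋆[ℂ] E →ₗ[ℂ] ℂ where
  toFun f := Module.Dual.extendRCLike (𝕜 := ℂ) (β f)
  map_add' f f' := by
    ext g
    rw [LinearMap.add_apply, Module.Dual.extendRCLike_apply, Module.Dual.extendRCLike_apply,
      Module.Dual.extendRCLike_apply, map_add, LinearMap.add_apply, LinearMap.add_apply]
    push_cast
    ring
  -- By `hβ` the scalar passes, conjugated, to the second argument, where the extension is already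
  -- complex linear.
  map_smul' c f := by
    ext g
    rw [LinearMap.smul_apply, ← LinearMap.map_smul, Module.Dual.extendRCLike_apply,
      Module.Dual.extendRCLike_apply, hβ, hβ, smul_comm]

theorem sesquilinearOfReal_apply (β : E →ₗ[ℝ] E →ₗ[ℝ] ℝ)
    (hβ : ∀ (c : ℂ) (f g : E), β (c • f) g = β f (starRingEnd ℂ c • g)) (f g : E) :
    sesquilinearOfReal β hβ f g = (β f g : ℂ) - Complex.I * (β f (Complex.I • g) : ℂ) :=
  Module.Dual.extendRCLike_apply _ _

end SesquilinearOfReal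

namespace PosAffiliated

variable {H : Type*} [NormedAddCommGroup H] [InnerProductSpace ℂ H] [CompleteSpace H]
  {M : VonNeumannAlgebra H} (a : PosAffiliated M)

/-- The real part `x ↦ (⟨x g, f⟩ + ⟨x f, g⟩) / 2` of the functional `x ↦ ⟨x g, f⟩`. -/
noncomputable def realVectorFunctional (f g : H) : M.toStarSubalgebra →ₗ[ℂ] ℂ :=
  (2⁻¹ : ℝ) • (M.vectorFunctional f g + M.vectorFunctional g f)

theorem realVectorFunctional_apply (f g : H) (x : M.toStarSubalgebra) :
    realVectorFunctional f g x =
      2⁻¹ * (⟪f, (x : H →L[ℂ] H) g⟫_ℂ + ⟪g, (x : H →L[ℂ] H) f⟫_ℂ) := by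
  rw [realVectorFunctional, LinearMap.smul_apply, Complex.real_smul]
  push_cast
  rfl

theorem realVectorFunctional_mem (f g : a.sqrt.domain) :
    realVectorFunctional (M := M) f g ∈ a.domH := by
  -- Real polarisation. Only the real part of `x ↦ ⟨x g, f⟩` is such a difference, which is why the
  -- form is first built over `ℝ`.
  have h : realVectorFunctional (M := M) f g =
      (4⁻¹ : ℝ) • ((a.vectorH (f + g) : M.toStarSubalgebra →ₗ[ℂ] ℂ) - a.vectorH (f - g)) := by
    ext x
    rw [realVectorFunctional_apply, LinearMap.smul_apply, LinearMap.sub_apply, Complex.real_smul,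
      coe_vectorH, coe_vectorH, VonNeumannAlgebra.vectorFunctional_apply,
      VonNeumannAlgebra.vectorFunctional_apply]
    simp only [Submodule.coe_add, Submodule.coe_sub, map_add, map_sub, inner_add_left,
      inner_add_right, inner_sub_left, inner_sub_right]
    push_cast
    ring
  rw [h]
  exact a.domH.smul_mem _ (a.domH.sub_mem (a.vectorH _).2 (a.vectorH _).2)

/-- `realVectorFunctional` as a real bilinear map to `𝔇_a^h`. -/
noncomputable def realVectorH : a.sqrt.domain →ₗ[ℝ] a.sqrt.domain →ₗ[ℝ] a.domH :=
  LinearMap.mk₂ ℝ (fun f g => ⟨realVectorFunctional f g, a.realVectorFunctional_mem f g⟩)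
    (fun f f' g => Subtype.ext <| LinearMap.ext fun x => by
      simp only [Submodule.coe_add, LinearMap.add_apply, realVectorFunctional_apply, map_add,
        inner_add_left, inner_add_right]
      ring)
    (fun c f g => Subtype.ext <| LinearMap.ext fun x => by
      simp only [Submodule.coe_smul, LinearMap.smul_apply, realVectorFunctional_apply,
        RCLike.real_smul_eq_coe_smul (K := ℂ) c, map_smul,
        inner_smul_left, inner_smul_right, smul_eq_mul]
      simp
      ring)
    (fun f g g' => Subtype.ext <| LinearMap.ext fun x => by
      simp only [Submodule.coe_add, LinearMap.add_apply, realVectorFunctional_apply, map_add,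
        inner_add_left, inner_add_right]
      ring)
    (fun c f g => Subtype.ext <| LinearMap.ext fun x => by
      simp only [Submodule.coe_smul, LinearMap.smul_apply, realVectorFunctional_apply,
        RCLike.real_smul_eq_coe_smul (K := ℂ) c, map_smul,
        inner_smul_left, inner_smul_right, smul_eq_mul]
      simp
      ring)

theorem coe_realVectorH (f g : a.sqrt.domain) :
    (a.realVectorH f g : M.toStarSubalgebra →ₗ[ℂ] ℂ) = realVectorFunctional (f : H) (g : H) := rfl

theorem realVectorH_self (f : a.sqrt.domain) : a.realVectorH f f = a.vectorH f := by
  refine Subtype.ext (LinearMap.ext fun x => ?_)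
  rw [coe_realVectorH, realVectorFunctional_apply, coe_vectorH,
    VonNeumannAlgebra.vectorFunctional_apply]
  ring

/-- Makes `dualForm` real on the diagonal. -/
theorem realVectorH_self_I (f : a.sqrt.domain) : a.realVectorH f (Complex.I • f) = 0 := by
  refine Subtype.ext (LinearMap.ext fun x => ?_)
  rw [coe_realVectorH, realVectorFunctional_apply]
  simp only [Submodule.coe_smul, map_smul, inner_smul_left, inner_smul_right, Complex.conj_I]
  simp

theorem realVectorH_smul (c : ℂ) (f g : a.sqrt.domain) :
    a.realVectorH (c • f) g = a.realVectorH f (starRingEnd ℂ c • g) := by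
  refine Subtype.ext (LinearMap.ext fun x => ?_)
  rw [coe_realVectorH, coe_realVectorH, realVectorFunctional_apply, realVectorFunctional_apply]
  simp only [Submodule.coe_smul, map_smul, inner_smul_left, inner_smul_right, Complex.conj_conj]

/-- The sesquilinear form on `D(a^{1/2})` defined by a linear functional on `𝔇_a^h`. -/
noncomputable def dualForm (ℓ : Module.Dual ℝ a.domH) :
    a.sqrt.domain →ₗ⋆[ℂ] a.sqrt.domain →ₗ[ℂ] ℂ :=
  sesquilinearOfReal (a.realVectorH.compr₂ ℓ)
    fun c f g => congrArg ℓ (a.realVectorH_smul c f g)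

theorem dualForm_apply (ℓ : Module.Dual ℝ a.domH) (f g : a.sqrt.domain) :
    a.dualForm ℓ f g =
      (ℓ (a.realVectorH f g) : ℂ) - Complex.I * (ℓ (a.realVectorH f (Complex.I • g)) : ℂ) :=
  sesquilinearOfReal_apply _ _ f g

theorem dualForm_self (ℓ : Module.Dual ℝ a.domH) (f : a.sqrt.domain) :
    a.dualForm ℓ f f = (ℓ (a.vectorH f) : ℂ) := by
  rw [dualForm_apply, realVectorH_self, realVectorH_self_I, map_zero, Complex.ofReal_zero,
    mul_zero, sub_zero]

/-- Functionals on `M` do not see unitaries of the commutant, since these commute with every `x ∈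
M`. This invariance is what forces the representing operator into `M`. -/
theorem realVectorH_unitary {u : H →L[ℂ] H} (hu : u ∈ unitary (H →L[ℂ] H)) (huM : u ∈ M.commutant)
    {f g f' g' : a.sqrt.domain} (hf : (f' : H) = u f) (hg : (g' : H) = u g) :
    a.realVectorH f' g' = a.realVectorH f g := by
  refine Subtype.ext (LinearMap.ext fun x => ?_)
  have hx : ∀ v, (x : H →L[ℂ] H) (u v) = u ((x : H →L[ℂ] H) v) := fun v =>
    DFunLike.congr_fun (VonNeumannAlgebra.mem_commutant_iff.1 huM _ x.2) v
  have hinner : ∀ v w, ⟪u v, u w⟫_ℂ = ⟪v, w⟫_ℂ := fun v w => by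
    rw [← ContinuousLinearMap.adjoint_inner_right, ← ContinuousLinearMap.star_eq_adjoint,
      ← mul_apply_eq_comp, (Unitary.mem_iff.1 hu).1]
    rfl
  rw [coe_realVectorH, coe_realVectorH, realVectorFunctional_apply, realVectorFunctional_apply,
    hf, hg, hx, hx, hinner, hinner]

theorem ext_of_inner_sqrt (ha : Function.Injective a.op) {S T : H →L[ℂ] H}
    (h : ∀ f g : a.sqrt.domain, ⟪a.sqrt f, S (a.sqrt g)⟫_ℂ = ⟪a.sqrt f, T (a.sqrt g)⟫_ℂ) :
    S = T := by
  have hd := a.denseRange_sqrt ha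
  ext v
  induction v using hd.induction_on with
  | hp => exact isClosed_eq (by fun_prop) (by fun_prop)
  | ih g =>
    refine ext_inner_left ℂ fun w => ?_
    induction w using hd.induction_on with
    | hp => exact isClosed_eq (by fun_prop) (by fun_prop)
    | ih f => exact h f g

/-- The quadratic form of `x` is real on the dense range of `a^{1/2}`, hence everywhere; over `ℂ`
this is self-adjointness. -/
theorem isSelfAdjoint_of_dualForm (ha : Function.Injective a.op) {ℓ : Module.Dual ℝ a.domH}
    {x : H →L[ℂ] H} (hx : ∀ f g : a.sqrt.domain, a.dualForm ℓ f g = ⟪a.sqrt f, x (a.sqrt g)⟫_ℂ) :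
    IsSelfAdjoint x := by
  refine ContinuousLinearMap.isSelfAdjoint_iff_isSymmetric.2 ?_
  rw [LinearMap.isSymmetric_iff_inner_map_self_real]
  intro v
  change (starRingEnd ℂ) ⟪x v, v⟫_ℂ = ⟪x v, v⟫_ℂ
  rw [inner_conj_symm]
  induction v using (a.denseRange_sqrt ha).induction_on with
  | hp => exact isClosed_eq (by fun_prop) (by fun_prop)
  | ih f =>
    change ⟪a.sqrt f, x (a.sqrt f)⟫_ℂ = ⟪x (a.sqrt f), a.sqrt f⟫_ℂ
    rw [← inner_conj_symm (x (a.sqrt f)), ← hx, dualForm_self, Complex.conj_ofReal]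

/-- For a unitary `u` of the commutant, `u* x u` represents the same form as `x`, so the two agree;
the bicommutant theorem is applied through unitaries. -/
theorem mem_of_dualForm (ha : Function.Injective a.op) {ℓ : Module.Dual ℝ a.domH}
    {x : H →L[ℂ] H} (hx : ∀ f g : a.sqrt.domain, a.dualForm ℓ f g = ⟪a.sqrt f, x (a.sqrt g)⟫_ℂ) :
    x ∈ M := by
  refine mem_of_commute_unitary fun u hu huM => ?_
  have h1 : star u * x * u = x := by
    refine a.ext_of_inner_sqrt ha fun f g => ?_
    obtain ⟨hf, hf'⟩ := a.sqrt_commutant huM f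
    obtain ⟨hg, hg'⟩ := a.sqrt_commutant huM g
    have h2 := hx ⟨_, hf⟩ ⟨_, hg⟩
    have h3 : a.realVectorH ⟨_, hf⟩ ⟨_, hg⟩ = a.realVectorH f g :=
      a.realVectorH_unitary hu huM rfl rfl
    have h4 : a.realVectorH ⟨_, hf⟩ (Complex.I • ⟨_, hg⟩) = a.realVectorH f (Complex.I • g) :=
      a.realVectorH_unitary hu huM rfl (map_smul u Complex.I (g : H)).symm
    rw [hf', hg', dualForm_apply, h3, h4, ← dualForm_apply, hx] at h2
    rw [h2, mul_apply_eq_comp, mul_apply_eq_comp, ContinuousLinearMap.star_eq_adjoint,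
      ContinuousLinearMap.adjoint_inner_right]
  calc u * x = u * (star u * x * u) := by rw [h1]
    _ = (u * star u) * x * u := by simp only [mul_assoc]
    _ = x * u := by rw [(Unitary.mem_iff.1 hu).2, one_mul]

/-- Every functional in `L_∞^{sa}(a)` is the limit functional of a self-adjoint `x ∈ M`. -/
theorem exists_limitFunctional_eq (ha : Function.Injective a.op) {ℓ : Module.Dual ℝ a.domH}
    (hℓ : ℓ ∈ a.LInftySA) : ∃ x : selfAdjoint M.toStarSubalgebra, a.limitFunctional x = ℓ := by
  obtain ⟨r, hr⟩ := id hℓ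
  obtain ⟨x, hx⟩ : ∃ x : H →L[ℂ] H, ∀ f g : a.sqrt.domain,
      a.dualForm ℓ f g = ⟪a.sqrt f, x (a.sqrt g)⟫_ℂ :=
    -- The bound is taken as `|r|` because `IsBetween` does not force `r ≥ 0`, for instance when `H
    -- = 0`.
    exists_operator_of_bounded_form a.sqrt.toFun (a.denseRange_sqrt ha)
      (a.dualForm ℓ) (abs_nonneg r) fun f => by
        rw [dualForm_self, Complex.norm_real]
        have h1 := abs_le.2 (hr _ (a.vectorFunctional_mem_domPos f))
        rw [toReal_eval_vectorFunctional] at h1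
        exact h1.trans (mul_le_mul_of_nonneg_right (le_abs_self r) (sq_nonneg _))
  let y : M.toStarSubalgebra := ⟨x, a.mem_of_dualForm ha hx⟩
  have hy : IsSelfAdjoint y := Subtype.ext (a.isSelfAdjoint_of_dualForm ha hx).star_eq
  have h0 : a.limitFunctional ⟨y, hy⟩ - ℓ = 0 := by
    refine a.eq_zero_of_vectorFunctional
      (a.LInftySA.sub_mem (a.limitFunctional_mem _) hℓ) fun f => ?_
    rw [LinearMap.sub_apply, limitFunctional_vectorFunctional, ← hx, dualForm_self,
      Complex.ofReal_re, sub_self]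
  exact ⟨⟨y, hy⟩, sub_eq_zero.1 h0⟩

/-! ### Forms, limit functionals and equality of norms -/

theorem form_apply (x : M.toStarSubalgebra) (f g : a.sqrt.domain) :
    a.form x f g = ⟪a.sqrt g, (x : H →L[ℂ] H) (a.sqrt f)⟫_ℂ := rfl

theorem form_injective (ha : Function.Injective a.op) : Function.Injective a.form :=
  fun x y h => Subtype.ext <| a.ext_of_inner_sqrt ha fun f g => by
    rw [← form_apply, ← form_apply, h]

theorem formSA_injective (ha : Function.Injective a.op) {x y : selfAdjoint M.toStarSubalgebra}
    (h : a.formSA x = a.formSA y) : x = y :=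
  Subtype.ext (a.form_injective ha (congrArg Subtype.val h))

theorem exists_formSA_eq (B : a.formsSA) : ∃ x, a.formSA x = B := by
  obtain ⟨B, x, hx, rfl⟩ := B
  exact ⟨⟨x, hx⟩, rfl⟩

/-- Values at vector functionals give the quadratic form of `x` on a dense subspace, and over `ℂ`
the quadratic form determines the operator. -/
theorem limitFunctional_injective (ha : Function.Injective a.op) :
    Function.Injective a.limitFunctional := by
  intro x y h
  have h1 : ∀ f : a.sqrt.domain, ⟪a.sqrt f, ((x : M.toStarSubalgebra) : H →L[ℂ] H) (a.sqrt f)⟫_ℂ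
      = ⟪a.sqrt f, ((y : M.toStarSubalgebra) : H →L[ℂ] H) (a.sqrt f)⟫_ℂ := fun f => by
    rw [inner_apply_eq_re (isSelfAdjoint_coe x), inner_apply_eq_re (isSelfAdjoint_coe y),
      ← limitFunctional_vectorFunctional, ← limitFunctional_vectorFunctional, h]
  have h2 : ((x : M.toStarSubalgebra) : H →L[ℂ] H) = ((y : M.toStarSubalgebra) : H →L[ℂ] H) := by
    refine ContinuousLinearMap.coe_injective ((ext_inner_map _ _).1 fun v => ?_)
    change ⟪((x : M.toStarSubalgebra) : H →L[ℂ] H) v, v⟫_ℂ =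
      ⟪((y : M.toStarSubalgebra) : H →L[ℂ] H) v, v⟫_ℂ
    induction v using (a.denseRange_sqrt ha).induction_on with
    | hp => exact isClosed_eq (by fun_prop) (by fun_prop)
    | ih f =>
      have h3 := congrArg (starRingEnd ℂ) (h1 f)
      rwa [inner_conj_symm, inner_conj_symm] at h3
  exact Subtype.ext (Subtype.ext h2)

theorem limitFunctional_eq_of_tendsto {x : selfAdjoint M.toStarSubalgebra}
    {ℓ : Module.Dual ℝ a.domH}
    (h : ∀ φ : a.domH, Tendsto (fun t : ℝ => (φ : M.toStarSubalgebra →ₗ[ℂ] ℂ)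
      (a.sqrtYosidaM t * (x : M.toStarSubalgebra) * a.sqrtYosidaM t)) atTop (𝓝 (ℓ φ : ℂ))) :
    a.limitFunctional x = ℓ :=
  LinearMap.ext fun φ =>
    Complex.ofReal_injective (tendsto_nhds_unique (a.tendsto_limitFunctional x φ) (h φ))

theorem limitFunctional_add (x y : selfAdjoint M.toStarSubalgebra) :
    a.limitFunctional (x + y) = a.limitFunctional x + a.limitFunctional y := by
  refine a.limitFunctional_eq_of_tendsto fun φ => ?_
  rw [LinearMap.add_apply, Complex.ofReal_add]
  refine ((a.tendsto_limitFunctional x φ).add (a.tendsto_limitFunctional y φ)).congr fun t => ?_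
  rw [← map_add, ← add_mul, ← mul_add]
  rfl

theorem isSelfAdjoint_ofReal_smul (r : ℝ) (x : selfAdjoint M.toStarSubalgebra) :
    IsSelfAdjoint ((r : ℂ) • (x : M.toStarSubalgebra)) := by
  rw [IsSelfAdjoint, star_smul, x.2.star_eq, Complex.star_def, Complex.conj_ofReal]

theorem limitFunctional_smul (r : ℝ) (x : selfAdjoint M.toStarSubalgebra) :
    a.limitFunctional ⟨_, isSelfAdjoint_ofReal_smul r x⟩ = r • a.limitFunctional x := by
  refine a.limitFunctional_eq_of_tendsto fun φ => ?_
  rw [LinearMap.smul_apply, smul_eq_mul, Complex.ofReal_mul]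
  refine ((a.tendsto_limitFunctional x φ).const_mul (r : ℂ)).congr fun t => ?_
  rw [← smul_eq_mul, ← LinearMap.map_smul, ← smul_mul_assoc, ← mul_smul_comm]

theorem formSA_add (x y : selfAdjoint M.toStarSubalgebra) :
    a.formSA (x + y) = a.formSA x + a.formSA y :=
  Subtype.ext <| LinearMap.ext fun f => LinearMap.ext fun _ =>
    inner_add_right _ (((x : M.toStarSubalgebra) : H →L[ℂ] H) (a.sqrt f)) _

theorem formSA_smul (r : ℝ) (x : selfAdjoint M.toStarSubalgebra) :
    a.formSA ⟨_, isSelfAdjoint_ofReal_smul r x⟩ = r • a.formSA x :=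
  Subtype.ext <| LinearMap.ext fun f => LinearMap.ext fun _ =>
    inner_smul_right _ (((x : M.toStarSubalgebra) : H →L[ℂ] H) (a.sqrt f)) _

/-- Both sides are infima of the same set of `r`, by the reduction to vector functionals. -/
theorem linftyNorm_limitFunctional (x : selfAdjoint M.toStarSubalgebra) :
    a.linftyNorm (a.limitFunctional x) = a.formSeminorm (a.formSA x) := by
  rw [linftyNorm, formSeminorm]
  congr 1
  ext r
  refine and_congr_right fun _ => ?_
  rw [isBetween_limitFunctional_iff]
  refine forall_congr' fun f => ?_
  have h1 : a.form 1 f f = ((‖a.sqrt f‖ ^ 2 : ℝ) : ℂ) := by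
    rw [form_apply]
    change ⟪a.sqrt f, a.sqrt f⟫_ℂ = _
    rw [inner_self_eq_norm_sq_to_K]
    norm_cast
  -- The seminorm compares complex numbers, so the diagonal values are first exhibited as real.
  have h2 : (a.formSA x : a.Form) f f = ((⟪a.sqrt f,
      ((x : M.toStarSubalgebra) : H →L[ℂ] H) (a.sqrt f)⟫_ℂ).re : ℂ) :=
    inner_apply_eq_re (isSelfAdjoint_coe x) _
  rw [h1, h2, abs_le]
  norm_cast
  rw [neg_mul]

/-! ### The dual norm -/

theorem bddBelow_aNorm (φ : a.domH) : BddBelow {r : ℝ | ∃ φ₁ ∈ a.domPos, ∃ φ₂ ∈ a.domPos,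
    (φ : M.toStarSubalgebra →ₗ[ℂ] ℂ) = φ₁ - φ₂ ∧
      r = (a.eval φ₁).toReal + (a.eval φ₂).toReal} := by
  refine ⟨0, ?_⟩
  rintro _ ⟨φ₁, -, φ₂, -, -, rfl⟩
  positivity

theorem aNorm_le_eval {φ : M.toStarSubalgebra →ₗ[ℂ] ℂ} (hφ : φ ∈ a.domPos) :
    a.aNorm ⟨φ, a.domPos_subset hφ⟩ ≤ (a.eval φ).toReal := by
  refine csInf_le (a.bddBelow_aNorm _) ⟨φ, hφ, 0, a.zero_mem_domPos, (sub_zero φ).symm, ?_⟩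
  have := a.eval_smul (zero_mem_predualPos (M := M)) le_rfl
  rw [zero_smul, ENNReal.ofReal_zero, zero_mul] at this
  rw [this, ENNReal.toReal_zero, add_zero]

theorem IsBetween.abs_le_mul_aNorm {ℓ : Module.Dual ℝ a.domH} {r : ℝ} (hr : 0 ≤ r)
    (h : a.IsBetween ℓ r) (φ : a.domH) : |ℓ φ| ≤ r * a.aNorm φ := by
  -- With `r ≥ 0` moved inside the infimum, it suffices to treat one decomposition at a time.
  rw [aNorm, ← smul_eq_mul, ← Real.sInf_smul_of_nonneg hr]
  obtain ⟨ψ₁, k₁, ψ₂, k₂, hψ⟩ := φ.2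
  refine le_csInf (Set.Nonempty.smul_set ⟨_, ψ₁, k₁, ψ₂, k₂, hψ, rfl⟩) ?_
  rintro _ ⟨_, ⟨φ₁, h₁, φ₂, h₂, hφ, rfl⟩, rfl⟩
  have e : φ = ⟨φ₁, a.domPos_subset h₁⟩ - ⟨φ₂, a.domPos_subset h₂⟩ := Subtype.ext hφ
  have b₁ := h φ₁ h₁
  have b₂ := h φ₂ h₂
  rw [e, map_sub]
  change _ ≤ r * ((a.eval φ₁).toReal + (a.eval φ₂).toReal)
  rw [abs_le]
  constructor <;> linarith [b₁.1, b₁.2, b₂.1, b₂.2]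

theorem isBetween_of_abs_le {ℓ : Module.Dual ℝ a.domH} {C : ℝ} (hC : 0 ≤ C)
    (h : ∀ φ : a.domH, |ℓ φ| ≤ C * a.aNorm φ) : a.IsBetween ℓ C := fun _ hφ =>
  abs_le.1 ((h _).trans (mul_le_mul_of_nonneg_left (a.aNorm_le_eval hφ) hC))

theorem aNorm_nonneg (φ : a.domH) : 0 ≤ a.aNorm φ := by
  refine Real.sInf_nonneg ?_
  rintro _ ⟨φ₁, -, φ₂, -, -, rfl⟩
  positivity

theorem mem_LInftySA_iff (ℓ : Module.Dual ℝ a.domH) :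
    ℓ ∈ a.LInftySA ↔ ∃ C : ℝ, ∀ φ : a.domH, |ℓ φ| ≤ C * a.aNorm φ := by
  constructor
  · rintro ⟨r, hr⟩
    refine ⟨|r|, IsBetween.abs_le_mul_aNorm a (abs_nonneg r) fun φ hφ => abs_le.1 ?_⟩
    exact (abs_le.2 (hr φ hφ)).trans
      (mul_le_mul_of_nonneg_right (le_abs_self r) ENNReal.toReal_nonneg)
  · rintro ⟨C, hC⟩
    exact ⟨|C|, a.isBetween_of_abs_le (abs_nonneg C) fun φ => (hC φ).trans
      (mul_le_mul_of_nonneg_right (le_abs_self C) (a.aNorm_nonneg φ))⟩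

/-- For each `C ≥ 0` the order bound and the norm bound are equivalent, so the two sets under the
infimum coincide. -/
theorem linftyNorm_eq (ℓ : Module.Dual ℝ a.domH) :
    a.linftyNorm ℓ = sInf {C : ℝ | 0 ≤ C ∧ ∀ φ : a.domH, |ℓ φ| ≤ C * a.aNorm φ} := by
  rw [linftyNorm]
  congr 1
  ext C
  exact and_congr_right fun hC =>
    ⟨IsBetween.abs_le_mul_aNorm a hC, a.isBetween_of_abs_le hC⟩

/-- The identification of `S_a(M^{sa})` with `L_∞^{sa}(a)`. -/
theorem exists_linearEquiv (ha : Function.Injective a.op) : ∃ Φ : a.formsSA ≃ₗ[ℝ] a.LInftySA,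
    ∀ x, (Φ (a.formSA x) : Module.Dual ℝ a.domH) = a.limitFunctional x := by
  -- By injectivity of `a` the form determines `x`, so the choice `e` is the inverse of `formSA` and
  -- inherits its linearity.
  choose e he' using a.exists_formSA_eq
  have he : ∀ x, e (a.formSA x) = x := fun x => a.formSA_injective ha (he' _)
  let F : a.formsSA →ₗ[ℝ] Module.Dual ℝ a.domH :=
    { toFun := fun B => a.limitFunctional (e B)
      map_add' := fun B C => by
        rw [← limitFunctional_add, ← he (e B + e C), formSA_add, he' B, he' C]
      map_smul' := fun r B => by
        rw [RingHom.id_apply, ← limitFunctional_smul, ← he ⟨_, isSelfAdjoint_ofReal_smul r (e B)⟩,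
          formSA_smul, he' B] }
  have hF : ∀ x, F (a.formSA x) = a.limitFunctional x := fun x =>
    congrArg a.limitFunctional (he x)
  have hmem : ∀ B, F B ∈ a.LInftySA := fun B => a.limitFunctional_mem (e B)
  have hbij : Function.Bijective (F.codRestrict a.LInftySA hmem) := by
    constructor
    · intro B C h
      have h1 : a.limitFunctional (e B) = a.limitFunctional (e C) := congrArg Subtype.val h
      rw [← he' B, ← he' C, a.limitFunctional_injective ha h1]
    · rintro ⟨ℓ, hℓ⟩
      have hx := a.exists_limitFunctional_eq ha hℓ
      obtain ⟨x, hx⟩ := hx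
      exact ⟨a.formSA x, Subtype.ext ((hF x).trans hx)⟩
  exact ⟨LinearEquiv.ofBijective _ hbij, hF⟩

end PosAffiliated

theorem mainTheorem3 {H : Type*} [NormedAddCommGroup H] [InnerProductSpace ℂ H] [CompleteSpace H]
    (M : VonNeumannAlgebra H) (a : PosAffiliated M) (ha : Function.Injective a.op) :
    -- `L_∞^{sa}(a)` is the dual of `(𝔇_a^h, ‖·‖_a)`, with the dual norm
    (∀ ℓ : Module.Dual ℝ a.domH,
      ℓ ∈ a.LInftySA ↔ ∃ C : ℝ, ∀ φ : a.domH, |ℓ φ| ≤ C * a.aNorm φ) ∧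
    (∀ ℓ ∈ a.LInftySA,
      a.linftyNorm ℓ = sInf {C : ℝ | 0 ≤ C ∧ ∀ φ : a.domH, |ℓ φ| ≤ C * a.aNorm φ}) ∧
    -- the identification of `S_a(M^{sa})` with `L_∞^{sa}(a)`
    ∃ Φ : a.formsSA ≃ₗ[ℝ] a.LInftySA,
      (∀ (x : selfAdjoint M.toStarSubalgebra) (φ : a.domH),
        Tendsto (fun t : ℝ => (φ : M.toStarSubalgebra →ₗ[ℂ] ℂ)
            (a.sqrtYosidaM t * (x : M.toStarSubalgebra) * a.sqrtYosidaM t))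
          atTop (𝓝 (((Φ (a.formSA x) : Module.Dual ℝ a.domH) φ : ℝ) : ℂ))) ∧
      ∀ B : a.formsSA, a.linftyNorm (Φ B) = a.formSeminorm B := by
  have hΦ := a.exists_linearEquiv ha
  obtain ⟨Φ, hΦ⟩ := hΦ
  refine ⟨a.mem_LInftySA_iff, fun ℓ _ => a.linftyNorm_eq ℓ, Φ, fun x φ => ?_, fun B => ?_⟩
  · rw [hΦ]
    exact a.tendsto_limitFunctional x φ
  · have hx := a.exists_formSA_eq B
    obtain ⟨x, rfl⟩ := hx
    rw [hΦ, a.linftyNorm_limitFunctional]
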